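/- Let $\alpha_0<\alpha<\beta<\beta_0$ be real numbers, let $K,G,L$ be $C^\infty$ positive functions on $]\alpha_0,\beta_0[$, and let $h,H\in[0,\infty]$. Consider the eigenvalue problem $$\frac{d}{dx}\Big(K\frac{dV}{dx}\Big)+(r\,G-L)V=0\ \text{ in } ]\alpha,\beta[,\qquad \Big(K\frac{dV}{dx}-hV\Big)(\alpha)=0,\qquad \Big(K\frac{dV}{dx}+HV\Big)(\beta)=0,$$ where for $h=\infty$ (resp. $H=\infty$) the boundary condition means $V(\alpha)=0$ (resp. $V(\beta)=0$). Let $\rho_1<\rho_2<\cdots$ be its eigenvalues in increasing order, and for each $j\ge 1$ let $V_j$ be an eigenfunction associated with $\rho_j$. Let $1\le m\le n$, let $A_m,\dots,A_n$ be real numbers with $A_mA_n\neq 0$, and put $Y=\sum_{j=m}^n A_jV_j$. Then, counting each zero $\xi$ of $Y$ with its multiplicity $\min\{p : \frac{d^pY}{dx^p}(\xi)\neq 0\}$, the function $Y$ has (1) at most $n-1$ zeros, and (2) at least $m-1$ zeros in the open interval $]\alpha,\beta[$ (in particular its zeros there are finite in number and of finite multiplicity). -/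

import Mathlib

open scoped ENNReal ContDiff

noncomputable section

/-- The data of a regular Sturm-Liouville eigenvalue problem on `[α, β] ⊂ ]α₀, β₀[`: smooth positive
coefficients `K, G, L` on `]α₀, β₀[`, and constants `h, H ∈ [0, ∞]` for the boundary conditions. -/
structure SturmLiouvilleProblem where
  (α₀ α β β₀ : ℝ)
  left_lt : α₀ < α
  lt : α < β
  lt_right : β < β₀
  (K G L : ℝ → ℝ)
  K_smooth : ContDiffOn ℝ ∞ K (Set.Ioo α₀ β₀)
  G_smooth : ContDiffOn ℝ ∞ G (Set.Ioo α₀ β₀)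
  L_smooth : ContDiffOn ℝ ∞ L (Set.Ioo α₀ β₀)
  K_pos : ∀ x ∈ Set.Ioo α₀ β₀, 0 < K x
  G_pos : ∀ x ∈ Set.Ioo α₀ β₀, 0 < G x
  L_pos : ∀ x ∈ Set.Ioo α₀ β₀, 0 < L x
  (h H : ℝ≥0∞)

namespace SturmLiouvilleProblem

/-- `(K V' - h V)(α) = 0`, understood as the Dirichlet condition `V(α) = 0` when `h = ∞`.
The derivative at the endpoint is one-sided. -/
def LeftBoundary (P : SturmLiouvilleProblem) (V : ℝ → ℝ) : Prop :=
  if P.h = ⊤ then V P.α = 0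
  else P.K P.α * derivWithin V (Set.Icc P.α P.β) P.α - P.h.toReal * V P.α = 0

/-- `(K V' + H V)(β) = 0`, understood as the Dirichlet condition `V(β) = 0` when `H = ∞`.
The derivative at the endpoint is one-sided. -/
def RightBoundary (P : SturmLiouvilleProblem) (V : ℝ → ℝ) : Prop :=
  if P.H = ⊤ then V P.β = 0
  else P.K P.β * derivWithin V (Set.Icc P.α P.β) P.β + P.H.toReal * V P.β = 0

/-- `V` is an eigenfunction for `r`: a nontrivial function, `C²` on `[α, β]`, which satisfies
`(K V')' + (r G - L) V = 0` in `]α, β[` and both boundary conditions. Its values outside `[α, β]`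
play no role. -/
structure IsEigenfunction (P : SturmLiouvilleProblem) (r : ℝ) (V : ℝ → ℝ) : Prop where
  contDiffOn : ContDiffOn ℝ 2 V (Set.Icc P.α P.β)
  equation : ∀ x ∈ Set.Ioo P.α P.β,
    deriv (fun t => P.K t * deriv V t) x + (r * P.G x - P.L x) * V x = 0
  left_boundary : P.LeftBoundary V
  right_boundary : P.RightBoundary V
  nontrivial : ∃ x ∈ Set.Icc P.α P.β, V x ≠ 0

/-- `r` is an eigenvalue of the problem. -/
def IsEigenvalue (P : SturmLiouvilleProblem) (r : ℝ) : Prop :=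
  ∃ V : ℝ → ℝ, P.IsEigenfunction r V

/-- `r` is the `j`-th eigenvalue `ρ_j` in increasing order `ρ_1 < ρ_2 < ⋯`: it is an eigenvalue,
and exactly `j - 1` eigenvalues are smaller. -/
def IsNthEigenvalue (P : SturmLiouvilleProblem) (j : ℕ) (r : ℝ) : Prop :=
  P.IsEigenvalue r ∧ {s : ℝ | P.IsEigenvalue s ∧ s < r}.encard + 1 = (j : ℕ∞)

end SturmLiouvilleProblem

/-- The order of vanishing of `U` at `ξ`: the least `p` with `U^(p)(ξ) ≠ 0`. It is `0` if
`U ξ ≠ 0`, and `⊤` if all derivatives vanish at `ξ`. -/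
def zeroMultiplicity (U : ℝ → ℝ) (ξ : ℝ) : ℕ∞ :=
  ⨅ (p : ℕ) (_ : iteratedDeriv p U ξ ≠ 0), (p : ℕ∞)

/-- The number of zeros of `U` in `]a, b[` counted with multiplicities: the sum of
`zeroMultiplicity U ξ` over `ξ ∈ ]a, b[`, as the supremum of all finite partial sums
(so it is finite only if there are finitely many zeros, all of finite order). -/
def numZeros (U : ℝ → ℝ) (a b : ℝ) : ℕ∞ :=
  ⨆ (s : Finset ℝ) (_ : (s : Set ℝ) ⊆ Set.Ioo a b), ∑ ξ ∈ s, zeroMultiplicity U ξ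

end

/-! The argument is Liouville's. Let `σ` be the lowest eigenvalue and `W` its eigenfunction, free of
zeros in the open interval. If `Y = ∑ A_j V_j` has `N ≥ 1` zeros there, so does `Y / W`, and by
Rolle `(Y / W)'` has at least `N - 1`. Multiplied by `K W²` it becomes `Q = ∑ A_j (K V_j' W - V_j K
W')`, which also vanishes at both endpoints by the boundary conditions; Rolle applied to `Q`
restores the lost zero. Since `Q' = -G W ∑ (ρ_j - σ) A_j V_j`, multiplying each `A_j` by `ρ_j - σ`
never decreases the number of zeros (`hasZeroCount_liouville`).

Iterating forwards and dividing by `(ρ_n - σ)^l`, the combinations tend to `A_n V_n`. Its `n - 1`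
zeros are simple, so for some `l` the combination has at most `n - 1` zeros, hence so has `Y`.
Backwards, the combinations with coefficients `A_j / (ρ_j - σ)^l`, rescaled, tend to `A_m V_m`,
which takes alternating signs at `m` points; for large `l` they have `m - 1` zeros, and `l` forward
steps carry these to `Y`.

Sturm's facts on single eigenfunctions come from the Prüfer transformation `V = R sin θ`, `K V' = R
cos θ`. The angle at `β` is continuous and strictly increasing in `r`, and `r` is an eigenvalue
exactly when that angle is `rightAngle + k π` with `k ∈ ℕ`; the `j`-th eigenvalue has `k = j - 1`,
and `V_j` vanishes where `θ` is a multiple of `π`. -/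

noncomputable section

/-! ### Zeros with multiplicity and Rolle's theorem -/

open Set Filter Topology

/-- `f` vanishes at `ξ` at least to order `k`. -/
def VanishesToOrder (f : ℝ → ℝ) (ξ : ℝ) (k : ℕ) : Prop :=
  ∀ p < k, iteratedDeriv p f ξ = 0

namespace VanishesToOrder

variable {f g : ℝ → ℝ} {ξ : ℝ} {k : ℕ}

theorem congr (hf : VanishesToOrder f ξ k) (h : f =ᶠ[𝓝 ξ] g) : VanishesToOrder g ξ k :=
  fun p hp => (h.iteratedDeriv_eq p).symm.trans (hf p hp)

theorem mul (hf : VanishesToOrder f ξ k) (hfs : ContDiffAt ℝ ∞ f ξ) (hgs : ContDiffAt ℝ ∞ g ξ) :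
    VanishesToOrder (f * g) ξ k := by
  intro p hp
  have h1 : ContDiffAt ℝ p f ξ := hfs.of_le (by exact_mod_cast le_top)
  have h2 : ContDiffAt ℝ p g ξ := hgs.of_le (by exact_mod_cast le_top)
  rw [iteratedDeriv_mul h1 h2]
  refine Finset.sum_eq_zero fun i hi => ?_
  rw [hf i (by grind)]
  simp

theorem deriv (hf : VanishesToOrder f ξ k) : VanishesToOrder (deriv f) ξ (k - 1) := by
  intro p hp
  rw [← iteratedDeriv_succ']
  exact hf _ (by omega)

theorem apply_eq_zero (hf : VanishesToOrder f ξ k) (hk : 1 ≤ k) : f ξ = 0 := by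
  simpa using hf 0 (by omega)

theorem deriv_eq_zero (hf : VanishesToOrder f ξ k) (hk : 2 ≤ k) : _root_.deriv f ξ = 0 := by
  simpa using hf 1 (by omega)

theorem one_iff : VanishesToOrder f ξ 1 ↔ f ξ = 0 := by
  simp [VanishesToOrder]

theorem le_zeroMultiplicity (hf : VanishesToOrder f ξ k) : (k : ℕ∞) ≤ zeroMultiplicity f ξ := by
  refine le_iInf₂ fun p hp => ?_
  by_contra! h
  exact hp (hf p (by exact_mod_cast h))

theorem of_le_zeroMultiplicity (h : (k : ℕ∞) ≤ zeroMultiplicity f ξ) : VanishesToOrder f ξ k := by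
  intro p hp
  by_contra hne
  have : zeroMultiplicity f ξ ≤ p := iInf₂_le p hne
  have := h.trans this
  exact absurd (by exact_mod_cast this) (not_le.2 hp)

end VanishesToOrder

/-- `f` has at least `N` zeros in `]a, b[`, counted with multiplicities. -/
def HasZeroCount (f : ℝ → ℝ) (a b : ℝ) (N : ℕ) : Prop :=
  ∃ (s : Finset ℝ) (μ : ℝ → ℕ), (s : Set ℝ) ⊆ Ioo a b ∧
    (∀ ξ ∈ s, VanishesToOrder f ξ (μ ξ)) ∧ N ≤ ∑ ξ ∈ s, μ ξ

/-- Rolle's theorem for finitely many zeros. -/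
theorem exists_finset_deriv_eq_zero {f : ℝ → ℝ} {I : Set ℝ} (hI : I.OrdConnected)
    (hf : ContinuousOn f I) (s : Finset ℝ) (hs : (s : Set ℝ) ⊆ I) (h0 : ∀ ξ ∈ s, f ξ = 0) :
    ∃ t : Finset ℝ, s.card ≤ t.card + 1 ∧ Disjoint s t ∧
      ∀ ξ ∈ t, deriv f ξ = 0 ∧ ∃ x ∈ s, ∃ y ∈ s, x < ξ ∧ ξ < y := by
  induction s using Finset.induction_on_max with
  | empty => exact ⟨∅, by simp⟩
  | insert M s hM ih =>
    obtain ⟨t, hcard, hdisj, ht⟩ := ih (fun x hx => hs (by simp_all)) (fun x hx => h0 x (by simp [hx]))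
    rcases s.eq_empty_or_nonempty with rfl | hne
    · exact ⟨∅, by simp⟩
    have hmem := s.max'_mem hne
    set M' := s.max' hne
    have hle : ∀ x ∈ s, x ≤ M' := fun x hx => s.le_max' x hx
    -- `M` lies to the right of all earlier points, so the critical point found in `]M', M[` is new
    -- and outside the set of zeros.
    obtain ⟨c, hc, hc0⟩ := exists_deriv_eq_zero (hM M' hmem)
      (hf.mono (hI.out (hs (by simp [hmem])) (hs (by simp))))
      (by rw [h0 M' (by simp [hmem]), h0 M (by simp)])
    have hct : c ∉ t := by
      intro h
      obtain ⟨-, x, hx, y, hy, hxy⟩ := ht c h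
      linarith [hle y hy, hc.1]
    have hMs : M ∉ s := fun h => (hM M h).false
    refine ⟨insert c t, ?_, ?_, ?_⟩
    · rw [Finset.card_insert_of_notMem hct, Finset.card_insert_of_notMem hMs]; omega
    · rw [Finset.disjoint_left]
      intro x hx hx'
      rcases Finset.mem_insert.1 hx with rfl | hx <;> rcases Finset.mem_insert.1 hx' with h | hx'
      · exact hc.2.ne' h
      · obtain ⟨-, z, hz, y, hy, hxy⟩ := ht _ hx'
        linarith [hM y hy]
      · linarith [hle x hx, hc.1]
      · exact Finset.disjoint_left.1 hdisj hx hx'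
    · intro ξ hξ
      rcases Finset.mem_insert.1 hξ with rfl | hξ
      · exact ⟨hc0, M', by simp [hmem], M, by simp, hc.1, hc.2⟩
      · obtain ⟨h, x, hx, y, hy, hxy⟩ := ht ξ hξ
        exact ⟨h, x, by simp [hx], y, by simp [hy], hxy⟩

namespace HasZeroCount

variable {f g : ℝ → ℝ} {a b : ℝ} {N : ℕ}

theorem congr (h : HasZeroCount f a b N) (hfg : EqOn f g (Ioo a b)) : HasZeroCount g a b N := by
  obtain ⟨s, μ, h1, h2, h3⟩ := h
  refine ⟨s, μ, h1, fun ξ hξ => (h2 ξ hξ).congr ?_, h3⟩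
  exact hfg.eventuallyEq_of_mem (Ioo_mem_nhds (h1 hξ).1 (h1 hξ).2)

theorem mul (h : HasZeroCount f a b N) (hf : ContDiffOn ℝ ∞ f (Ioo a b))
    (hg : ContDiffOn ℝ ∞ g (Ioo a b)) : HasZeroCount (f * g) a b N := by
  obtain ⟨s, μ, h1, h2, h3⟩ := h
  refine ⟨s, μ, h1, fun ξ hξ => ?_, h3⟩
  have hn := Ioo_mem_nhds (h1 hξ).1 (h1 hξ).2
  exact (h2 ξ hξ).mul (hf.contDiffAt hn) (hg.contDiffAt hn)

theorem exists_pos (h : HasZeroCount f a b N) :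
    ∃ (s : Finset ℝ) (μ : ℝ → ℕ), (s : Set ℝ) ⊆ Ioo a b ∧
    (∀ ξ ∈ s, VanishesToOrder f ξ (μ ξ)) ∧ (∀ ξ ∈ s, 1 ≤ μ ξ) ∧ N ≤ ∑ ξ ∈ s, μ ξ := by
  obtain ⟨s, μ, h1, h2, h3⟩ := h
  refine ⟨s.filter (fun ξ => 1 ≤ μ ξ), μ, fun x hx => h1 (by simp_all), fun x hx => h2 x (by simp_all),
    fun x hx => by simp_all, h3.trans (le_of_eq ?_)⟩
  rw [Finset.sum_filter]
  refine Finset.sum_congr rfl fun x _ => ?_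
  split_ifs <;> omega

/-- Differentiation costs one order at each point of `s`, and each Rolle point in `t` gives one
back; `hN` is this balance. -/
theorem deriv_of_finset {s t : Finset ℝ} {μ : ℝ → ℕ} (hs : (s : Set ℝ) ⊆ Ioo a b)
    (ht : (t : Set ℝ) ⊆ Ioo a b) (hst : Disjoint s t)
    (hμ : ∀ ξ ∈ s, VanishesToOrder f ξ (μ ξ)) (ht0 : ∀ ξ ∈ t, deriv f ξ = 0)
    (hN : N + s.card ≤ ∑ ξ ∈ s, μ ξ + t.card) : HasZeroCount (deriv f) a b N := by
  refine ⟨s ∪ t, fun ξ => if ξ ∈ t then 1 else μ ξ - 1, ?_, ?_, ?_⟩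
  · rw [Finset.coe_union]; exact union_subset hs ht
  · intro ξ hξ
    by_cases h : ξ ∈ t
    · simpa [h, VanishesToOrder.one_iff] using ht0 ξ h
    · simp only [h, if_false]
      exact (hμ ξ (by simp_all)).deriv
  · rw [Finset.sum_union hst]
    have e1 : ∑ ξ ∈ t, (if ξ ∈ t then 1 else μ ξ - 1) = t.card := by
      rw [Finset.sum_congr rfl (fun x hx => if_pos hx)]; simp
    have e2 : ∑ ξ ∈ s, μ ξ ≤ ∑ ξ ∈ s, (if ξ ∈ t then 1 else μ ξ - 1) + s.card := by
      rw [Finset.card_eq_sum_ones, ← Finset.sum_add_distrib]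
      refine Finset.sum_le_sum fun x hx => ?_
      rw [if_neg (Finset.disjoint_left.1 hst hx)]
      omega
    omega

/-- Rolle's theorem for zeros counted with multiplicities. -/
theorem deriv (h : HasZeroCount f a b (N + 1)) (hf : ContinuousOn f (Ioo a b)) :
    HasZeroCount (deriv f) a b N := by
  obtain ⟨s, μ, h1, h2, h3, h4⟩ := h.exists_pos
  obtain ⟨t, ht1, ht2, ht3⟩ := exists_finset_deriv_eq_zero ordConnected_Ioo hf s h1
    fun ξ hξ => (h2 ξ hξ).apply_eq_zero (h3 ξ hξ)
  refine deriv_of_finset h1 ?_ ht2 h2 (fun ξ hξ => (ht3 ξ hξ).1) (by omega)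
  intro ξ hξ
  obtain ⟨-, x, hx, y, hy, hxy⟩ := ht3 ξ hξ
  exact ⟨(h1 hx).1.trans hxy.1, hxy.2.trans (h1 hy).2⟩

/-- Rolle's theorem for zeros counted with multiplicities, for a function which also vanishes at
both endpoints. -/
theorem deriv_of_endpoints (h : HasZeroCount f a b N) (hab : a < b)
    (hf : ContinuousOn f (Icc a b)) (ha : f a = 0) (hb : f b = 0) :
    HasZeroCount (_root_.deriv f) a b (N + 1) := by
  obtain ⟨s, μ, h1, h2, h3, h4⟩ := h.exists_pos
  have has : a ∉ s := fun h => (h1 h).1.false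
  have hbs : b ∉ s := fun h => (h1 h).2.false
  have hS : ((insert a (insert b s) : Finset ℝ) : Set ℝ) ⊆ Icc a b := by
    intro x hx
    simp only [Finset.coe_insert, mem_insert_iff] at hx
    rcases hx with rfl | rfl | hx
    · exact left_mem_Icc.2 hab.le
    · exact right_mem_Icc.2 hab.le
    · exact Ioo_subset_Icc_self (h1 hx)
  -- The endpoints enlarge the Rolle set by two points but carry no multiplicity, so nothing is
  -- asked of the derivative there.
  obtain ⟨t, ht1, ht2, ht3⟩ := exists_finset_deriv_eq_zero ordConnected_Icc hf
    (insert a (insert b s)) hS (by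
      intro ξ hξ
      simp only [Finset.mem_insert] at hξ
      rcases hξ with rfl | rfl | hξ
      · exact ha
      · exact hb
      · exact (h2 ξ hξ).apply_eq_zero (h3 ξ hξ))
  rw [Finset.card_insert_of_notMem (by simp [hab.ne, has]), Finset.card_insert_of_notMem hbs] at ht1
  refine deriv_of_finset h1 ?_ (ht2.mono_left ?_) h2 (fun ξ hξ => (ht3 ξ hξ).1) (by omega)
  · intro ξ hξ
    obtain ⟨-, x, hx, y, hy, hxy⟩ := ht3 ξ hξ
    exact ⟨(hS hx).1.trans_lt hxy.1, hxy.2.trans_le (hS hy).2⟩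
  · exact fun x hx => by simp [hx]

theorem le_numZeros (h : HasZeroCount f a b N) : (N : ℕ∞) ≤ numZeros f a b := by
  obtain ⟨s, μ, h1, h2, h3⟩ := h
  calc (N : ℕ∞) ≤ ((∑ ξ ∈ s, μ ξ : ℕ) : ℕ∞) := by exact_mod_cast h3
    _ = ∑ ξ ∈ s, (μ ξ : ℕ∞) := by push_cast; rfl
    _ ≤ ∑ ξ ∈ s, zeroMultiplicity f ξ :=
      Finset.sum_le_sum fun ξ hξ => (h2 ξ hξ).le_zeroMultiplicity
    _ ≤ numZeros f a b := le_iSup₂ (f := fun (s : Finset ℝ) (_ : (s : Set ℝ) ⊆ Ioo a b) =>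
        ∑ ξ ∈ s, zeroMultiplicity f ξ) s h1

end HasZeroCount

/-- Multiplicities may be infinite, so they are truncated at `N + 1`: either one of them alone
reaches that value, or the truncation changes nothing. -/
theorem numZeros_le_of_not_hasZeroCount {f : ℝ → ℝ} {a b : ℝ} {N : ℕ}
    (h : ¬ HasZeroCount f a b (N + 1)) : numZeros f a b ≤ N := by
  refine iSup₂_le fun s hs => ?_
  by_contra! hlt
  refine h ⟨s, fun ξ => (min (zeroMultiplicity f ξ) ((N + 1 : ℕ) : ℕ∞)).toNat, hs, fun ξ _ => ?_, ?_⟩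
  · apply VanishesToOrder.of_le_zeroMultiplicity
    rw [ENat.natCast_toNat (ne_top_of_le_ne_top (ENat.natCast_ne_top _) (min_le_right _ _))]
    exact min_le_left _ _
  · have hle : ((N + 1 : ℕ) : ℕ∞) ≤ ∑ ξ ∈ s, min (zeroMultiplicity f ξ) ((N + 1 : ℕ) : ℕ∞) := by
      by_cases hbig : ∃ ξ ∈ s, ((N + 1 : ℕ) : ℕ∞) ≤ zeroMultiplicity f ξ
      · obtain ⟨ξ, hξ, hb⟩ := hbig
        refine le_trans (le_of_eq (min_eq_right hb).symm)
          (Finset.single_le_sum (f := fun ξ => min (zeroMultiplicity f ξ) ((N + 1 : ℕ) : ℕ∞))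
            (fun _ _ => zero_le) hξ)
      · push Not at hbig
        rw [Finset.sum_congr rfl fun ξ hξ => min_eq_left (hbig ξ hξ).le]
        rw [Nat.cast_add, Nat.cast_one]
        exact Order.add_one_le_of_lt hlt
    have : ∑ ξ ∈ s, min (zeroMultiplicity f ξ) ((N + 1 : ℕ) : ℕ∞) =
        ((∑ ξ ∈ s, (min (zeroMultiplicity f ξ) ((N + 1 : ℕ) : ℕ∞)).toNat : ℕ) : ℕ∞) := by
      rw [Nat.cast_sum]
      refine Finset.sum_congr rfl fun ξ _ => ?_
      rw [ENat.natCast_toNat (ne_top_of_le_ne_top (ENat.natCast_ne_top _) (min_le_right _ _))]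
    rw [this] at hle
    exact_mod_cast hle

/-! ### The Prüfer transformation -/

namespace SturmLiouvilleProblem

open Real

variable (P : SturmLiouvilleProblem)

/-- An open interval which contains `[α, β]`, with closure in `]α₀, β₀[`. -/
def nbhd : Set ℝ := Ioo ((P.α₀ + P.α) / 2) ((P.β + P.β₀) / 2)

theorem isOpen_nbhd : IsOpen P.nbhd := isOpen_Ioo

theorem Icc_nbhd_subset : Icc ((P.α₀ + P.α) / 2) ((P.β + P.β₀) / 2) ⊆ Ioo P.α₀ P.β₀ := by
  intro x hx
  have := P.left_lt
  have := P.lt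
  have := P.lt_right
  constructor <;> linarith [hx.1, hx.2]

theorem nbhd_subset : P.nbhd ⊆ Ioo P.α₀ P.β₀ := Ioo_subset_Icc_self.trans P.Icc_nbhd_subset

theorem Icc_subset_nbhd : Icc P.α P.β ⊆ P.nbhd := by
  intro x hx
  have := P.left_lt
  have := P.lt_right
  constructor <;> linarith [hx.1, hx.2]

theorem left_mem : P.α ∈ Icc P.α P.β := left_mem_Icc.2 P.lt.le

theorem right_mem : P.β ∈ Icc P.α P.β := right_mem_Icc.2 P.lt.le

/-- The zeroth order coefficient `r G - L`. -/
def potential (r x : ℝ) : ℝ := r * P.G x - P.L x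

theorem continuousOn_potential (r : ℝ) : ContinuousOn (P.potential r) (Ioo P.α₀ P.β₀) :=
  (continuousOn_const.mul P.G_smooth.continuousOn).sub P.L_smooth.continuousOn

theorem continuousOn_inv : ContinuousOn (fun x => (P.K x)⁻¹) (Ioo P.α₀ P.β₀) :=
  P.K_smooth.continuousOn.inv₀ fun x hx => (P.K_pos x hx).ne'

/-- The right-hand side of the differential equation satisfied by the Prüfer angle. -/
def angleField (r x θ : ℝ) : ℝ := cos θ ^ 2 * (P.K x)⁻¹ + P.potential r x * sin θ ^ 2

/-- Here `θ` enters only through `sin² θ`, which is bounded and 1-Lipschitz; the field is therefore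
bounded and Lipschitz uniformly in `θ`. -/
theorem angleField_eq (r x θ : ℝ) :
    P.angleField r x θ = (P.K x)⁻¹ + (P.potential r x - (P.K x)⁻¹) * sin θ ^ 2 := by
  rw [angleField, cos_sq']; ring

theorem exists_bound (r : ℝ) : ∃ C : ℝ, 0 < C ∧
    ∀ x ∈ Icc ((P.α₀ + P.α) / 2) ((P.β + P.β₀) / 2),
      |(P.K x)⁻¹| ≤ C ∧ |P.potential r x - (P.K x)⁻¹| ≤ C := by
  have h1 := P.continuousOn_inv.mono P.Icc_nbhd_subset
  have h2 := (P.continuousOn_potential r).mono P.Icc_nbhd_subset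
  obtain ⟨C₁, hC₁⟩ := isCompact_Icc.exists_bound_of_continuousOn h1
  obtain ⟨C₂, hC₂⟩ := isCompact_Icc.exists_bound_of_continuousOn (h2.sub h1)
  refine ⟨max 1 (max C₁ C₂), by positivity, fun x hx => ⟨?_, ?_⟩⟩
  · exact (hC₁ x hx).trans (by simp)
  · exact (hC₂ x hx).trans (by simp)

theorem abs_sin_sq_sub_sin_sq_le (a b : ℝ) : |sin a ^ 2 - sin b ^ 2| ≤ |a - b| := by
  have h : sin a ^ 2 - sin b ^ 2 = sin (a - b) * sin (a + b) := by
    rw [sin_sub, sin_add]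
    have := sin_sq_add_cos_sq a
    have := sin_sq_add_cos_sq b
    grind
  rw [h, abs_mul]
  calc |sin (a - b)| * |sin (a + b)| ≤ |a - b| * 1 :=
        mul_le_mul abs_sin_le_abs (abs_sin_le_one _) (abs_nonneg _) (abs_nonneg _)
    _ = _ := mul_one _

theorem abs_angleField_sub_le {r x C : ℝ} (hC : |P.potential r x - (P.K x)⁻¹| ≤ C) (a b : ℝ) :
    |P.angleField r x a - P.angleField r x b| ≤ C * |a - b| := by
  rw [angleField_eq, angleField_eq, add_sub_add_left_eq_sub, ← mul_sub, abs_mul]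
  exact mul_le_mul hC (abs_sin_sq_sub_sin_sq_le a b) (abs_nonneg _) ((abs_nonneg _).trans hC)

/-- The Prüfer angle imposed at `α` by the left boundary condition. -/
def leftAngle : ℝ := if P.h = ⊤ then 0 else π / 2 - arctan P.h.toReal

/-- The Prüfer angle, modulo `π`, imposed at `β` by the right boundary condition. -/
def rightAngle : ℝ := if P.H = ⊤ then π else π / 2 + arctan P.H.toReal

theorem leftAngle_nonneg : 0 ≤ P.leftAngle := by
  unfold leftAngle
  split_ifs
  · exact le_rfl
  · linarith [arctan_lt_pi_div_two P.h.toReal]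

theorem leftAngle_le : P.leftAngle ≤ π / 2 := by
  unfold leftAngle
  split_ifs
  · positivity
  · linarith [arctan_nonneg.2 (ENNReal.toReal_nonneg (a := P.h))]

theorem le_rightAngle : π / 2 ≤ P.rightAngle := by
  unfold rightAngle
  split_ifs
  · linarith [pi_pos]
  · linarith [arctan_nonneg.2 (ENNReal.toReal_nonneg (a := P.H))]

theorem rightAngle_le : P.rightAngle ≤ π := by
  unfold rightAngle
  split_ifs
  · exact le_rfl
  · linarith [arctan_lt_pi_div_two P.H.toReal]

/-- Dirichlet and Robin conditions take one form: `(V, K V')` is parallel to `(sin γ, cos γ)`, where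
`γ` is the boundary angle. -/
theorem leftBoundary_iff (V : ℝ → ℝ) : P.LeftBoundary V ↔
    V P.α * cos P.leftAngle - P.K P.α * derivWithin V (Icc P.α P.β) P.α * sin P.leftAngle = 0 := by
  unfold LeftBoundary leftAngle
  split_ifs
  · simp
  · have hc := cos_arctan_pos P.h.toReal
    rw [cos_pi_div_two_sub, sin_pi_div_two_sub, ← tan_mul_cos hc.ne', tan_arctan]
    constructor
    · intro h
      linear_combination -cos (arctan P.h.toReal) * h
    · intro h
      refine (mul_left_inj' hc.ne').1 ?_
      linear_combination -h

theorem rightBoundary_iff (V : ℝ → ℝ) : P.RightBoundary V ↔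
    V P.β * cos P.rightAngle - P.K P.β * derivWithin V (Icc P.α P.β) P.β * sin P.rightAngle
      = 0 := by
  unfold RightBoundary rightAngle
  split_ifs
  · simp
  · have hc := cos_arctan_pos P.H.toReal
    rw [add_comm (π / 2), cos_add_pi_div_two, sin_add_pi_div_two, ← tan_mul_cos hc.ne', tan_arctan]
    constructor
    · intro h
      linear_combination -cos (arctan P.H.toReal) * h
    · intro h
      refine (mul_left_inj' hc.ne').1 ?_
      linear_combination -h

theorem exists_angle (r : ℝ) : ∃ θ : ℝ → ℝ, θ P.α = P.leftAngle ∧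
    ∀ x ∈ P.nbhd, HasDerivAt θ (P.angleField r x (θ x)) x := by
  obtain ⟨C, hC0, hC⟩ := P.exists_bound r
  have hα : P.α ∈ Icc ((P.α₀ + P.α) / 2) ((P.β + P.β₀) / 2) :=
    Ioo_subset_Icc_self (P.Icc_subset_nbhd P.left_mem)
  set T : ℝ := max ((P.β + P.β₀) / 2 - P.α) (P.α - (P.α₀ + P.α) / 2)
  have hT : 0 ≤ T := (sub_nonneg.2 hα.2).trans (le_max_left _ _)
  -- The field is bounded by `2 C` for every `θ`, so a ball of radius `2 C T` contains the solution
  -- over the whole interval.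
  have hPL : IsPicardLindelof (P.angleField r)
      (⟨P.α, hα⟩ : Icc ((P.α₀ + P.α) / 2) ((P.β + P.β₀) / 2)) P.leftAngle
      (⟨2 * C * T, by positivity⟩ : NNReal) 0 ⟨2 * C, by positivity⟩ ⟨C, hC0.le⟩ := by
    refine ⟨fun t ht => ?_, fun x _ => ?_, fun t ht x _ => ?_, ?_⟩
    · refine LipschitzWith.lipschitzOnWith (LipschitzWith.of_dist_le_mul fun x y => ?_)
      exact P.abs_angleField_sub_le (hC t ht).2 x y
    · exact ((continuousOn_const.mul P.continuousOn_inv).add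
        ((P.continuousOn_potential r).mul continuousOn_const)).mono P.Icc_nbhd_subset
    · rw [angleField_eq]
      refine (norm_add_le _ _).trans ?_
      have h1 := (hC t ht).1
      have h2 : |(P.potential r t - (P.K t)⁻¹) * sin x ^ 2| ≤ C * 1 := by
        rw [abs_mul]
        refine mul_le_mul (hC t ht).2 ?_ (abs_nonneg _) hC0.le
        rw [abs_of_nonneg (sq_nonneg _)]
        exact sin_sq_le_one x
      change |_| + |_| ≤ 2 * C
      linarith
    · change 2 * C * T ≤ 2 * C * T - 0
      simp
  obtain ⟨θ, h0, hθ⟩ := hPL.exists_eq_forall_mem_Icc_hasDerivWithinAt₀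
  exact ⟨θ, h0, fun x hx => (hθ x (Ioo_subset_Icc_self hx)).hasDerivAt (Icc_mem_nhds hx.1 hx.2)⟩

/-- The Prüfer angle of the solution which satisfies the left boundary condition. -/
def angle (r : ℝ) : ℝ → ℝ := (P.exists_angle r).choose

theorem angle_left (r : ℝ) : P.angle r P.α = P.leftAngle := (P.exists_angle r).choose_spec.1

theorem hasDerivAt_angle (r : ℝ) {x : ℝ} (hx : x ∈ P.nbhd) :
    HasDerivAt (P.angle r) (P.angleField r x (P.angle r x)) x :=
  (P.exists_angle r).choose_spec.2 x hx

theorem continuousOn_angle (r : ℝ) : ContinuousOn (P.angle r) P.nbhd :=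
  fun _ hx => (P.hasDerivAt_angle r hx).continuousAt.continuousWithinAt

theorem K_pos_of_mem {x : ℝ} (hx : x ∈ P.nbhd) : 0 < P.K x := P.K_pos x (P.nbhd_subset hx)

/-- With the angle known, the amplitude obeys a scalar linear equation, solved by an exponential;
hence its positivity. -/
theorem exists_amplitude (r : ℝ) : ∃ R : ℝ → ℝ, (∀ x, 0 < R x) ∧
    ∀ x ∈ P.nbhd, HasDerivAt R
      (((P.K x)⁻¹ - P.potential r x) * sin (P.angle r x) * cos (P.angle r x) * R x) x := by
  set φ : ℝ → ℝ := fun x =>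
    ((P.K x)⁻¹ - P.potential r x) * sin (P.angle r x) * cos (P.angle r x)
  have hφ : ContinuousOn φ P.nbhd := by
    have h := P.continuousOn_angle r
    exact (((P.continuousOn_inv.sub (P.continuousOn_potential r)).mono P.nbhd_subset).mul
      (continuous_sin.comp_continuousOn h)).mul (continuous_cos.comp_continuousOn h)
  refine ⟨fun x => exp (∫ t in P.α..x, φ t), fun x => exp_pos _, fun x hx => ?_⟩
  have hi : IntervalIntegrable φ MeasureTheory.volume P.α x :=
    (hφ.mono (ordConnected_Ioo.uIcc_subset (P.Icc_subset_nbhd P.left_mem) hx)).intervalIntegrable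
  have := (intervalIntegral.integral_hasDerivAt_right hi
    (hφ.stronglyMeasurableAtFilter P.isOpen_nbhd x hx)
    (hφ.continuousAt (P.isOpen_nbhd.mem_nhds hx))).exp
  convert this using 1
  ring

/-- The amplitude in the Prüfer transformation. -/
def amplitude (r : ℝ) : ℝ → ℝ := (P.exists_amplitude r).choose

theorem amplitude_pos (r x : ℝ) : 0 < P.amplitude r x := (P.exists_amplitude r).choose_spec.1 x

theorem hasDerivAt_amplitude (r : ℝ) {x : ℝ} (hx : x ∈ P.nbhd) :
    HasDerivAt (P.amplitude r) (((P.K x)⁻¹ - P.potential r x) * sin (P.angle r x) *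
      cos (P.angle r x) * P.amplitude r x) x :=
  (P.exists_amplitude r).choose_spec.2 x hx

/-- The solution of the initial value problem given by the left boundary condition. -/
def shoot (r x : ℝ) : ℝ := P.amplitude r x * sin (P.angle r x)

/-- The quantity `K V'` for the solution `V` of the initial value problem. -/
def shootFlux (r x : ℝ) : ℝ := P.amplitude r x * cos (P.angle r x)

theorem hasDerivAt_shoot (r : ℝ) {x : ℝ} (hx : x ∈ P.nbhd) :
    HasDerivAt (P.shoot r) ((P.K x)⁻¹ * P.shootFlux r x) x := by
  refine ((P.hasDerivAt_amplitude r hx).mul (P.hasDerivAt_angle r hx).sin).congr_deriv ?_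
  rw [angleField, shootFlux]
  linear_combination ((P.K x)⁻¹ * P.amplitude r x * cos (P.angle r x)) *
    sin_sq_add_cos_sq (P.angle r x)

theorem hasDerivAt_shootFlux (r : ℝ) {x : ℝ} (hx : x ∈ P.nbhd) :
    HasDerivAt (P.shootFlux r) (-(P.potential r x * P.shoot r x)) x := by
  refine ((P.hasDerivAt_amplitude r hx).mul (P.hasDerivAt_angle r hx).cos).congr_deriv ?_
  rw [angleField, shoot]
  linear_combination (-P.potential r x * P.amplitude r x * sin (P.angle r x)) *
    sin_sq_add_cos_sq (P.angle r x)

end SturmLiouvilleProblem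

/-! ### Dependence of the Prüfer angle on `x` and `r` -/

/-- A function which can cross the level `c` only upwards stays above `c`. -/
theorem lt_of_deriv_pos_of_eq {f f' : ℝ → ℝ} {x y c : ℝ} (hxy : x < y)
    (hf : ∀ t ∈ Icc x y, HasDerivAt f (f' t) t) (hx : c ≤ f x)
    (h : ∀ t ∈ Icc x y, f t = c → 0 < f' t) : c < f y := by
  have hle : ∀ ⦃t⦄, t ∈ Icc x y → (fun t => -f t) t ≤ (fun _ => -c) t := by
    refine image_le_of_deriv_right_lt_deriv_boundary (f' := fun t => -f' t) (B' := fun _ => 0)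
      (fun t ht => (hf t ht).neg.continuousAt.continuousWithinAt)
      (fun t ht => (hf t (Ico_subset_Icc_self ht)).neg.hasDerivWithinAt) (by simpa using hx)
      (fun t => hasDerivAt_const _ _) fun t ht hft => ?_
    simpa using h t (Ico_subset_Icc_self ht) (by simpa using hft)
  have hy : y ∈ Icc x y := right_mem_Icc.2 hxy.le
  refine lt_of_le_of_ne (by simpa using hle hy) fun heq => ?_
  have hd : 0 < f' y := h y hy heq.symm
  have hev : ∀ᶠ t in 𝓝[<] y, 0 < slope f y t :=
    ((hasDerivAt_iff_tendsto_slope.1 (hf y hy)).mono_left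
      (nhdsWithin_mono y fun t ht => ne_of_lt ht)).eventually (lt_mem_nhds hd)
  obtain ⟨t, ht, hxt, hty⟩ := (hev.and (Ioo_mem_nhdsLT hxy)).exists
  have h1 : c ≤ f t := by simpa using hle ⟨hxt.le, hty.le⟩
  rw [slope_def_field] at ht
  have h2 : (f t - f y) / (t - y) ≤ 0 :=
    div_nonpos_of_nonneg_of_nonpos (by linarith) (by linarith)
  linarith

namespace SturmLiouvilleProblem

open Real

variable (P : SturmLiouvilleProblem)

theorem angleField_int_mul_pi (r x : ℝ) (k : ℤ) : P.angleField r x (k * π) = (P.K x)⁻¹ := by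
  rw [angleField_eq, sin_int_mul_pi]; ring

/-- At a multiple of `π` the field equals `1 / K > 0`, so each multiple is crossed at most once, and
upwards. -/
theorem int_mul_pi_lt_angle {r x y : ℝ} {k : ℤ} (hx : x ∈ Icc P.α P.β) (hy : y ∈ Icc P.α P.β)
    (hxy : x < y) (h : k * π ≤ P.angle r x) : k * π < P.angle r y := by
  have hsub : Icc x y ⊆ P.nbhd := (Icc_subset_Icc hx.1 hy.2).trans P.Icc_subset_nbhd
  refine lt_of_deriv_pos_of_eq hxy (fun t ht => P.hasDerivAt_angle r (hsub ht)) h fun t ht he => ?_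
  rw [he, angleField_int_mul_pi]
  exact inv_pos.2 (P.K_pos_of_mem (hsub ht))

theorem angle_pos {r x : ℝ} (hx : x ∈ Ioc P.α P.β) : 0 < P.angle r x := by
  have := P.int_mul_pi_lt_angle (r := r) (k := 0) P.left_mem (Ioc_subset_Icc_self hx) hx.1
    (by simpa [angle_left] using P.leftAngle_nonneg)
  simpa using this

/-- For `r = 0` the slope at angle `π / 2` is `-L < 0`, so that level cannot be crossed upwards.
This puts `0` below every eigenvalue and gives the lower end for the intermediate value theorem. -/
theorem angle_zero_right_lt : P.angle 0 P.β < π / 2 := by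
  have := lt_of_deriv_pos_of_eq (f := fun t => -P.angle 0 t) (c := -(π / 2)) P.lt
    (fun t ht => (P.hasDerivAt_angle 0 (P.Icc_subset_nbhd ht)).neg)
    (by simpa [angle_left] using P.leftAngle_le) (by
      intro t ht he
      have he : P.angle 0 t = π / 2 := by linarith
      rw [he]
      have := P.L_pos t (P.nbhd_subset (P.Icc_subset_nbhd ht))
      simpa [angleField, potential] using this)
  linarith

theorem angleField_mono {r r' x : ℝ} (h : r ≤ r') (hx : x ∈ P.nbhd) (θ : ℝ) :
    P.angleField r x θ ≤ P.angleField r' x θ := by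
  have := P.G_pos x (P.nbhd_subset hx)
  unfold angleField potential
  gcongr

theorem angle_mono {r r' x : ℝ} (h : r ≤ r') (hx : x ∈ Icc P.α P.β) :
    P.angle r x ≤ P.angle r' x := by
  obtain ⟨C, hC0, hC⟩ := P.exists_bound r'
  -- The barrier grows at rate `C + 1`, beyond the Lipschitz constant `C`, which gives the strict
  -- inequality required at a contact point; then `ε → 0`.
  have key : ∀ ε > 0, P.angle r x ≤ P.angle r' x + ε * exp ((C + 1) * x) := by
    intro ε hε
    have hsub := P.Icc_subset_nbhd
    have hB : ∀ t ∈ P.nbhd, HasDerivAt (fun t => P.angle r' t + ε * exp ((C + 1) * t))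
        (P.angleField r' t (P.angle r' t) + ε * (exp ((C + 1) * t) * (C + 1))) t := by
      intro t ht
      refine (P.hasDerivAt_angle r' ht).add (HasDerivAt.const_mul ε ?_)
      simpa using ((hasDerivAt_id t).const_mul (C + 1)).exp
    refine image_le_of_deriv_right_lt_deriv_boundary'
      (fun t ht => (P.hasDerivAt_angle r (hsub ht)).continuousAt.continuousWithinAt)
      (fun t ht => (P.hasDerivAt_angle r (hsub (Ico_subset_Icc_self ht))).hasDerivWithinAt)
      (by rw [angle_left, angle_left]; have := exp_pos ((C + 1) * P.α); nlinarith)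
      (fun t ht => (hB t (hsub ht)).continuousAt.continuousWithinAt)
      (fun t ht => (hB t (hsub (Ico_subset_Icc_self ht))).hasDerivWithinAt) ?_ hx
    intro t ht he
    have ht' := hsub (Ico_subset_Icc_self ht)
    have h1 := P.angleField_mono h ht' (P.angle r t)
    have h2 := P.abs_angleField_sub_le (hC t (Ioo_subset_Icc_self ht')).2
      (P.angle r t) (P.angle r' t)
    have hpos : 0 < ε * exp ((C + 1) * t) := by positivity
    rw [show P.angle r t - P.angle r' t = ε * exp ((C + 1) * t) by linarith, abs_of_pos hpos] at h2
    have h3 := (le_abs_self _).trans h2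
    nlinarith
  have hlim : Tendsto (fun ε : ℝ => P.angle r' x + ε * exp ((C + 1) * x)) (𝓝[>] 0)
      (𝓝 (P.angle r' x + 0 * exp ((C + 1) * x))) := by
    refine Tendsto.mono_left ?_ nhdsWithin_le_nhds
    exact (continuous_const.add (continuous_id.mul continuous_const)).tendsto 0
  rw [zero_mul, add_zero] at hlim
  exact ge_of_tendsto hlim (eventually_mem_nhdsWithin.mono key)

/-- If the angles agreed at `β`, the nonnegative function `exp (C x) (θ' - θ)`, being nondecreasing,
would vanish on all of `[α, β]`. Equal angles have equal fields, so `(r' - r) G sin² θ = 0`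
throughout the interior; but `sin θ` cannot vanish identically, its derivative at a zero being `cos
θ / K ≠ 0`. -/
theorem strictMono_angle_right : StrictMono fun r => P.angle r P.β := by
  intro r r' h
  refine lt_of_le_of_ne (P.angle_mono h.le P.right_mem) fun heq => ?_
  obtain ⟨C, hC0, hC⟩ := P.exists_bound r'
  have hsub := P.Icc_subset_nbhd
  set g : ℝ → ℝ := fun x => exp (C * x) * (P.angle r' x - P.angle r x)
  have hg : ∀ x ∈ P.nbhd, HasDerivAt g (exp (C * x) * (C * (P.angle r' x - P.angle r x) +
      (P.angleField r' x (P.angle r' x) - P.angleField r x (P.angle r x)))) x := by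
    intro x hx
    have h1 : HasDerivAt (fun x => exp (C * x)) (exp (C * x) * C) x := by
      simpa using ((hasDerivAt_id x).const_mul C).exp
    refine (h1.mul ((P.hasDerivAt_angle r' hx).sub (P.hasDerivAt_angle r hx))).congr_deriv ?_
    rw [Pi.sub_apply]
    ring
  have hmono : MonotoneOn g (Icc P.α P.β) := by
    refine monotoneOn_of_deriv_nonneg (convex_Icc _ _)
      (fun x hx => (hg x (hsub hx)).continuousAt.continuousWithinAt)
      (fun x hx => (hg x (hsub (interior_subset hx))).differentiableAt.differentiableWithinAt)
      fun x hx => ?_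
    have hx := interior_subset hx
    rw [(hg x (hsub hx)).deriv]
    refine mul_nonneg (exp_pos _).le ?_
    have h1 := P.angleField_mono h.le (hsub hx) (P.angle r x)
    have h2 := P.abs_angleField_sub_le (hC x (Ioo_subset_Icc_self (hsub hx))).2
      (P.angle r' x) (P.angle r x)
    rw [abs_of_nonneg (sub_nonneg.2 (P.angle_mono h.le hx))] at h2
    linarith [neg_le_of_abs_le h2]
  have hzero : ∀ x ∈ Icc P.α P.β, P.angle r' x = P.angle r x := by
    intro x hx
    have h1 : g x ≤ 0 := by
      refine (hmono hx P.right_mem hx.2).trans (le_of_eq ?_)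
      simp only [g]
      rw [show P.angle r P.β = P.angle r' P.β from heq]
      simp
    have h2 := P.angle_mono h.le hx
    have h3 := exp_pos (C * x)
    have h4 : exp (C * x) * (P.angle r' x - P.angle r x) ≤ 0 := h1
    nlinarith
  have hsin : ∀ x ∈ Ioo P.α P.β, sin (P.angle r x) = 0 := by
    intro x hx
    have hx' := hsub (Ioo_subset_Icc_self hx)
    have hev : P.angle r' =ᶠ[𝓝 x] P.angle r := by
      filter_upwards [Ioo_mem_nhds hx.1 hx.2] with t ht using hzero t (Ioo_subset_Icc_self ht)
    have h1 := ((P.hasDerivAt_angle r' hx').congr_of_eventuallyEq hev.symm).unique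
      (P.hasDerivAt_angle r hx')
    rw [hev.eq_of_nhds, angleField, angleField, potential, potential] at h1
    have h2 : (r' - r) * P.G x * sin (P.angle r x) ^ 2 = 0 := by linear_combination h1
    have h3 := (P.G_pos x (P.nbhd_subset hx')).ne'
    simpa [sub_ne_zero.2 h.ne', h3] using h2
  obtain ⟨x, hx⟩ := exists_between P.lt
  have hx' := hsub (Ioo_subset_Icc_self hx)
  have hd := (P.hasDerivAt_angle r hx').sin
  have hev : (fun t => sin (P.angle r t)) =ᶠ[𝓝 x] fun _ => 0 := by
    filter_upwards [Ioo_mem_nhds hx.1 hx.2] with t ht using hsin t ht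
  have h0 := (hd.congr_of_eventuallyEq hev.symm).unique (hasDerivAt_const x 0)
  have hs := hsin x hx
  have hc : cos (P.angle r x) ≠ 0 := by
    intro hc
    have := sin_sq_add_cos_sq (P.angle r x)
    simp [hs, hc] at this
  rw [angleField_eq, hs] at h0
  simp [hc, (P.K_pos_of_mem hx').ne'] at h0

/-- The angle for `r'` solves the equation for `r` up to an error `|r' - r| M`, where `M` bounds
`G`; Grönwall's inequality concludes. -/
theorem continuous_angle_right : Continuous fun r => P.angle r P.β := by
  rw [continuous_iff_continuousAt]
  intro r
  obtain ⟨C, hC0, hC⟩ := P.exists_bound r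
  have hsub := P.Icc_subset_nbhd
  obtain ⟨M, hM⟩ := isCompact_Icc.exists_bound_of_continuousOn
    (P.G_smooth.continuousOn.mono (hsub.trans P.nbhd_subset))
  have hM0 : 0 ≤ M := (norm_nonneg _).trans (hM P.α P.left_mem)
  have hbound : ∀ r', dist (P.angle r' P.β) (P.angle r P.β) ≤
      gronwallBound 0 C (|r' - r| * M + 0) (P.β - P.α) := by
    intro r'
    refine dist_le_of_approx_trajectories_ODE_of_mem (K := ⟨C, hC0.le⟩) (s := fun _ => univ)
      (v := P.angleField r)
      (fun t ht => LipschitzWith.lipschitzOnWith (LipschitzWith.of_dist_le_mul fun x y =>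
        P.abs_angleField_sub_le
          (hC t (Ioo_subset_Icc_self (hsub (Ico_subset_Icc_self ht)))).2 x y))
      (fun t ht => (P.hasDerivAt_angle r' (hsub ht)).continuousAt.continuousWithinAt)
      (fun t ht => (P.hasDerivAt_angle r' (hsub (Ico_subset_Icc_self ht))).hasDerivWithinAt)
      (fun t ht => ?_) (fun _ _ => mem_univ _)
      (fun t ht => (P.hasDerivAt_angle r (hsub ht)).continuousAt.continuousWithinAt)
      (fun t ht => (P.hasDerivAt_angle r (hsub (Ico_subset_Icc_self ht))).hasDerivWithinAt)
      (fun t ht => (dist_self _).le) (fun _ _ => mem_univ _)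
      (by rw [angle_left, angle_left, dist_self]) P.β P.right_mem
    rw [dist_eq, show P.angleField r' t (P.angle r' t) - P.angleField r t (P.angle r' t) =
      (r' - r) * (P.G t * sin (P.angle r' t) ^ 2) by
        simp only [angleField, potential]; ring, abs_mul]
    refine mul_le_mul_of_nonneg_left ?_ (abs_nonneg _)
    rw [abs_mul, abs_of_nonneg (sq_nonneg (sin _))]
    exact (mul_le_of_le_one_right (abs_nonneg _) (sin_sq_le_one _)).trans
      (hM t (Ico_subset_Icc_self ht))
  rw [ContinuousAt, tendsto_iff_dist_tendsto_zero]
  refine squeeze_zero (fun _ => dist_nonneg) hbound ?_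
  have hcont : Continuous fun r' => gronwallBound 0 C (|r' - r| * M + 0) (P.β - P.α) :=
    (gronwallBound_continuous_ε 0 C (P.β - P.α)).comp (by fun_prop)
  simpa [gronwallBound_ε0_δ0] using hcont.tendsto r

end SturmLiouvilleProblem

/-! ### Eigenfunctions as multiples of the shooting solution -/

theorem eq_left_of_hasDerivAt_zero {f : ℝ → ℝ} {a b : ℝ} (hf : ContinuousOn f (Icc a b))
    (hd : ∀ x ∈ Ioo a b, HasDerivAt f 0 x) {x : ℝ} (hx : x ∈ Icc a b) : f x = f a := by
  have hdiff : DifferentiableOn ℝ f (interior (Icc a b)) := by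
    rw [interior_Icc]
    exact fun t ht => (hd t ht).differentiableAt.differentiableWithinAt
  have hderiv : ∀ t ∈ interior (Icc a b), deriv f t = 0 := by
    rw [interior_Icc]
    exact fun t ht => (hd t ht).deriv
  have ha : a ∈ Icc a b := left_mem_Icc.2 (hx.1.trans hx.2)
  exact le_antisymm
    (antitoneOn_of_deriv_nonpos (convex_Icc a b) hf hdiff (fun t ht => (hderiv t ht).le) ha hx hx.1)
    (monotoneOn_of_deriv_nonneg (convex_Icc a b) hf hdiff (fun t ht => (hderiv t ht).ge) ha hx hx.1)

namespace SturmLiouvilleProblem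

open Real

variable {P : SturmLiouvilleProblem}

theorem uniqueDiffOn_Icc (P : SturmLiouvilleProblem) : UniqueDiffOn ℝ (Icc P.α P.β) :=
  _root_.uniqueDiffOn_Icc P.lt

/-- The quantity `K V'`, with one-sided derivatives at the endpoints. -/
def flux (P : SturmLiouvilleProblem) (V : ℝ → ℝ) (x : ℝ) : ℝ :=
  P.K x * derivWithin V (Icc P.α P.β) x

theorem derivWithin_eq_inv_mul_flux (V : ℝ → ℝ) {x : ℝ} (hx : x ∈ Icc P.α P.β) :
    derivWithin V (Icc P.α P.β) x = (P.K x)⁻¹ * P.flux V x := by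
  rw [flux, inv_mul_cancel_left₀ (P.K_pos_of_mem (P.Icc_subset_nbhd hx)).ne']

namespace IsEigenfunction

variable {r : ℝ} {V : ℝ → ℝ}

theorem continuousOn (e : P.IsEigenfunction r V) : ContinuousOn V (Icc P.α P.β) :=
  e.contDiffOn.continuousOn

theorem contDiffOn_derivWithin (e : P.IsEigenfunction r V) :
    ContDiffOn ℝ 1 (derivWithin V (Icc P.α P.β)) (Icc P.α P.β) :=
  e.contDiffOn.derivWithin P.uniqueDiffOn_Icc (by norm_num)

theorem hasDerivWithinAt (e : P.IsEigenfunction r V) {x : ℝ} (hx : x ∈ Icc P.α P.β) :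
    HasDerivWithinAt V (derivWithin V (Icc P.α P.β) x) (Icc P.α P.β) x :=
  (e.contDiffOn.differentiableOn (by norm_num) x hx).hasDerivWithinAt

theorem hasDerivAt (e : P.IsEigenfunction r V) {x : ℝ} (hx : x ∈ Ioo P.α P.β) :
    HasDerivAt V (derivWithin V (Icc P.α P.β) x) x :=
  (e.hasDerivWithinAt (Ioo_subset_Icc_self hx)).hasDerivAt (Icc_mem_nhds hx.1 hx.2)

theorem continuousOn_flux (e : P.IsEigenfunction r V) : ContinuousOn (P.flux V) (Icc P.α P.β) :=
  (P.K_smooth.continuousOn.mono (P.Icc_subset_nbhd.trans P.nbhd_subset)).mul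
    e.contDiffOn_derivWithin.continuousOn

theorem hasDerivAt_flux (e : P.IsEigenfunction r V) {x : ℝ} (hx : x ∈ Ioo P.α P.β) :
    HasDerivAt (P.flux V) (-(P.potential r x * V x)) x := by
  have hx' := P.nbhd_subset (P.Icc_subset_nbhd (Ioo_subset_Icc_self hx))
  have hK : DifferentiableAt ℝ P.K x :=
    (P.K_smooth.contDiffAt (Ioo_mem_nhds hx'.1 hx'.2)).differentiableAt (by simp)
  have hD : DifferentiableAt ℝ (derivWithin V (Icc P.α P.β)) x :=
    (e.contDiffOn_derivWithin.contDiffAt (Icc_mem_nhds hx.1 hx.2)).differentiableAt (by simp)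
  have hev : (fun t => P.K t * deriv V t) =ᶠ[𝓝 x] P.flux V := by
    filter_upwards [Ioo_mem_nhds hx.1 hx.2] with t ht
    rw [flux, (e.hasDerivAt ht).deriv]
  have h1 := (hK.mul hD).hasDerivAt
  have h2 := e.equation x hx
  rw [hev.deriv_eq] at h2
  exact h1.congr_deriv (by rw [potential]; exact eq_neg_of_add_eq_zero_left h2)

/-- Two solutions for the same `r` have constant Wronskian, and it vanishes at `α` by the common
left boundary condition. -/
theorem wronskian_shoot_eq_zero (e : P.IsEigenfunction r V) {x : ℝ} (hx : x ∈ Icc P.α P.β) :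
    V x * P.shootFlux r x - P.flux V x * P.shoot r x = 0 := by
  have hsub := P.Icc_subset_nbhd
  have hs : ContinuousOn (P.shoot r) (Icc P.α P.β) := fun t ht =>
    (P.hasDerivAt_shoot r (hsub ht)).continuousAt.continuousWithinAt
  have hf : ContinuousOn (P.shootFlux r) (Icc P.α P.β) := fun t ht =>
    (P.hasDerivAt_shootFlux r (hsub ht)).continuousAt.continuousWithinAt
  refine (eq_left_of_hasDerivAt_zero (f := V * P.shootFlux r - P.flux V * P.shoot r)
    ((e.continuousOn.mul hf).sub (e.continuousOn_flux.mul hs)) (fun t ht => ?_) hx).trans ?_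
  · have ht' := Ioo_subset_Icc_self ht
    refine (((e.hasDerivAt ht).mul (P.hasDerivAt_shootFlux r (hsub ht'))).sub
      ((e.hasDerivAt_flux ht).mul (P.hasDerivAt_shoot r (hsub ht')))).congr_deriv ?_
    rw [derivWithin_eq_inv_mul_flux V ht']
    ring
  · have h := (P.leftBoundary_iff V).1 e.left_boundary
    simp only [Pi.sub_apply, Pi.mul_apply, shoot, shootFlux, angle_left, flux]
    linear_combination P.amplitude r P.α * h

/-- The vanishing Wronskian makes `(V, K V')` equal to `E (sin θ, cos θ)`. The factor `E` obeys the
same linear equation as the amplitude, so their quotient is constant, and nonzero because `V` is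
nontrivial. -/
theorem exists_eq_shoot (e : P.IsEigenfunction r V) : ∃ c : ℝ, c ≠ 0 ∧
    ∀ x ∈ Icc P.α P.β, V x = c * P.shoot r x ∧ P.flux V x = c * P.shootFlux r x := by
  have hsub := P.Icc_subset_nbhd
  set E : ℝ → ℝ := fun x => V x * sin (P.angle r x) + P.flux V x * cos (P.angle r x)
  have hw : ∀ x ∈ Icc P.α P.β, V x * cos (P.angle r x) = P.flux V x * sin (P.angle r x) := by
    intro x hx
    have := e.wronskian_shoot_eq_zero hx
    have hR := P.amplitude_pos r x
    refine mul_left_cancel₀ hR.ne' ?_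
    rw [shoot, shootFlux] at this
    linear_combination this
  have hV : ∀ x ∈ Icc P.α P.β, V x = E x * sin (P.angle r x) := by
    intro x hx
    simp only [E]
    linear_combination cos (P.angle r x) * hw x hx - V x * sin_sq_add_cos_sq (P.angle r x)
  have hF : ∀ x ∈ Icc P.α P.β, P.flux V x = E x * cos (P.angle r x) := by
    intro x hx
    simp only [E]
    linear_combination -sin (P.angle r x) * hw x hx -
      P.flux V x * sin_sq_add_cos_sq (P.angle r x)
  have hθ : ContinuousOn (P.angle r) (Icc P.α P.β) := (P.continuousOn_angle r).mono hsub
  have hR : ContinuousOn (P.amplitude r) (Icc P.α P.β) := fun t ht =>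
    (P.hasDerivAt_amplitude r (hsub ht)).continuousAt.continuousWithinAt
  have hE : ContinuousOn E (Icc P.α P.β) :=
    (e.continuousOn.mul (continuous_sin.comp_continuousOn hθ)).add
      (e.continuousOn_flux.mul (continuous_cos.comp_continuousOn hθ))
  have hconst : ∀ x ∈ Icc P.α P.β, E x / P.amplitude r x = E P.α / P.amplitude r P.α := by
    intro x hx
    refine eq_left_of_hasDerivAt_zero (f := fun x => E x / P.amplitude r x)
      (hE.div hR fun t _ => (P.amplitude_pos r t).ne') (fun t ht => ?_) hx
    have ht' := Ioo_subset_Icc_self ht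
    have hθt := P.hasDerivAt_angle r (hsub ht')
    have hEt : HasDerivAt E (((P.K t)⁻¹ - P.potential r t) * sin (P.angle r t) *
      cos (P.angle r t) * E t) t := by
      refine (((e.hasDerivAt ht).mul hθt.sin).add ((e.hasDerivAt_flux ht).mul hθt.cos)).congr_deriv ?_
      rw [derivWithin_eq_inv_mul_flux V ht']
      linear_combination P.angleField r t (P.angle r t) * hw t ht' +
        (P.K t)⁻¹ * sin (P.angle r t) * hF t ht' -
        P.potential r t * cos (P.angle r t) * hV t ht'
    refine (hEt.div (P.hasDerivAt_amplitude r (hsub ht')) (P.amplitude_pos r t).ne').congr_deriv ?_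
    rw [div_eq_zero_iff]
    left
    ring
  have hEc : ∀ x ∈ Icc P.α P.β, E x = E P.α / P.amplitude r P.α * P.amplitude r x := fun x hx =>
    (div_eq_iff (P.amplitude_pos r x).ne').1 (hconst x hx)
  refine ⟨E P.α / P.amplitude r P.α, ?_, fun x hx => ⟨?_, ?_⟩⟩
  · intro h0
    obtain ⟨x, hx, hne⟩ := e.nontrivial
    rw [hV x hx, hEc x hx, h0] at hne
    simp at hne
  · rw [shoot, ← mul_assoc, ← hEc x hx, ← hV x hx]
  · rw [shootFlux, ← mul_assoc, ← hEc x hx, ← hF x hx]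

theorem flux_ne_zero (e : P.IsEigenfunction r V) {x : ℝ} (hx : x ∈ Icc P.α P.β) (h0 : V x = 0) :
    P.flux V x ≠ 0 := by
  obtain ⟨c, hc, h⟩ := e.exists_eq_shoot
  intro hf
  have hR := (P.amplitude_pos r x).ne'
  have h1 := (h x hx).1.symm.trans h0
  have h2 := (h x hx).2.symm.trans hf
  simp only [shoot, shootFlux, mul_eq_zero, hc, hR, false_or] at h1 h2
  simpa [h1, h2] using sin_sq_add_cos_sq (P.angle r x)

theorem derivWithin_ne_zero (e : P.IsEigenfunction r V) {x : ℝ} (hx : x ∈ Icc P.α P.β)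
    (h0 : V x = 0) : derivWithin V (Icc P.α P.β) x ≠ 0 := by
  intro h
  exact e.flux_ne_zero hx h0 (by rw [flux, h, mul_zero])

theorem exists_index (e : P.IsEigenfunction r V) :
    ∃ k : ℕ, P.angle r P.β = P.rightAngle + k * π := by
  obtain ⟨c, hc, h⟩ := e.exists_eq_shoot
  have hR := (P.amplitude_pos r P.β).ne'
  have h1 := (P.rightBoundary_iff V).1 e.right_boundary
  obtain ⟨h2, h3⟩ := h P.β P.right_mem
  rw [flux] at h3
  rw [h2, h3, shoot, shootFlux] at h1
  have h4 : sin (P.angle r P.β - P.rightAngle) = 0 := by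
    rw [sin_sub]
    refine mul_left_cancel₀ (mul_ne_zero hc hR) ?_
    linear_combination h1
  obtain ⟨n, hn⟩ := sin_eq_zero_iff.1 h4
  have hpos := P.angle_pos (r := r) (right_mem_Ioc.2 P.lt)
  have hle := P.rightAngle_le
  -- The angle at `β` is positive and `rightAngle ≤ π`, which excludes negative indices.
  have hn0 : (-1 : ℝ) < n := by
    have : (-1) * π < n * π := by linarith
    exact lt_of_mul_lt_mul_right this pi_pos.le
  have hn1 : 0 ≤ n := by
    have : (-1 : ℤ) < n := by exact_mod_cast hn0
    omega
  lift n to ℕ using hn1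
  refine ⟨n, ?_⟩
  push_cast at hn
  linarith

end IsEigenfunction

theorem isEigenfunction_shoot {r : ℝ} {k : ℕ} (hk : P.angle r P.β = P.rightAngle + k * π) :
    P.IsEigenfunction r (P.shoot r) := by
  have hsub := P.Icc_subset_nbhd
  have hd : ∀ x ∈ Icc P.α P.β, P.K x * derivWithin (P.shoot r) (Icc P.α P.β) x =
      P.shootFlux r x := by
    intro x hx
    rw [(P.hasDerivAt_shoot r (hsub hx)).hasDerivWithinAt.derivWithin (P.uniqueDiffOn_Icc x hx),
      mul_inv_cancel_left₀ (P.K_pos_of_mem (hsub hx)).ne']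
  refine ⟨?_, fun x hx => ?_, ?_, ?_, ?_⟩
  · have hs : ContinuousOn (P.shoot r) P.nbhd := fun t ht =>
      (P.hasDerivAt_shoot r ht).continuousAt.continuousWithinAt
    have hflux : ContDiffOn ℝ 1 (P.shootFlux r) P.nbhd := by
      rw [show (1 : WithTop ℕ∞) = 0 + 1 by norm_num, contDiffOn_succ_iff_deriv_of_isOpen P.isOpen_nbhd]
      refine ⟨fun t ht => (P.hasDerivAt_shootFlux r ht).differentiableAt.differentiableWithinAt,
        by simp, contDiffOn_zero.2 ?_⟩
      exact (((P.continuousOn_potential r).mono P.nbhd_subset).mul hs).neg.congr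
        fun t ht => (P.hasDerivAt_shootFlux r ht).deriv
    have hshoot : ContDiffOn ℝ 2 (P.shoot r) P.nbhd := by
      rw [show (2 : WithTop ℕ∞) = 1 + 1 by norm_num, contDiffOn_succ_iff_deriv_of_isOpen P.isOpen_nbhd]
      refine ⟨fun t ht => (P.hasDerivAt_shoot r ht).differentiableAt.differentiableWithinAt,
        by simp, ?_⟩
      have hK : ContDiffOn ℝ 1 (fun x => (P.K x)⁻¹) P.nbhd :=
        ((P.K_smooth.of_le (by exact_mod_cast le_top)).mono P.nbhd_subset).inv
          fun t ht => (P.K_pos_of_mem ht).ne'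
      exact (hK.mul hflux).congr fun t ht => (P.hasDerivAt_shoot r ht).deriv
    exact hshoot.mono hsub
  · have hx' := hsub (Ioo_subset_Icc_self hx)
    have hev : (fun t => P.K t * deriv (P.shoot r) t) =ᶠ[𝓝 x] P.shootFlux r := by
      filter_upwards [P.isOpen_nbhd.mem_nhds hx'] with t ht
      rw [(P.hasDerivAt_shoot r ht).deriv, mul_inv_cancel_left₀ (P.K_pos_of_mem ht).ne']
    rw [hev.deriv_eq, (P.hasDerivAt_shootFlux r hx').deriv, potential]
    ring
  · rw [leftBoundary_iff, hd _ P.left_mem, shoot, shootFlux, angle_left]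
    ring
  · rw [rightBoundary_iff, hd _ P.right_mem, shoot, shootFlux, hk, sin_add_nat_mul_pi,
      cos_add_nat_mul_pi]
    ring
  · by_contra! h
    have hz : ∀ x ∈ Ioo P.α P.β, P.shootFlux r x = 0 := by
      intro x hx
      have hev : P.shoot r =ᶠ[𝓝 x] fun _ => 0 := by
        filter_upwards [Ioo_mem_nhds hx.1 hx.2] with t ht using h t (Ioo_subset_Icc_self ht)
      rw [← hd x (Ioo_subset_Icc_self hx), derivWithin_of_mem_nhds (Icc_mem_nhds hx.1 hx.2),
        hev.deriv_eq]
      simp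
    obtain ⟨x, hx⟩ := exists_between P.lt
    have h1 := h x (Ioo_subset_Icc_self hx)
    have h2 := hz x hx
    have hR := (P.amplitude_pos r x).ne'
    simp only [shoot, shootFlux, mul_eq_zero, hR, false_or] at h1 h2
    simpa [h1, h2] using sin_sq_add_cos_sq (P.angle r x)

/-! ### Counting eigenvalues by the angle at `β` -/

theorem isEigenvalue_iff {r : ℝ} :
    P.IsEigenvalue r ↔ ∃ k : ℕ, P.angle r P.β = P.rightAngle + k * π :=
  ⟨fun ⟨_, e⟩ => e.exists_index, fun ⟨_, hk⟩ => ⟨_, isEigenfunction_shoot hk⟩⟩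

/-- Intermediate values between `0` and `r`. Only levels below one already attained are needed, so
large `r` need not be studied. -/
theorem exists_angle_right_eq {r : ℝ} {k j : ℕ} (hk : P.angle r P.β = P.rightAngle + k * π)
    (hj : j < k) : ∃ s, P.angle s P.β = P.rightAngle + j * π := by
  refine mem_range_of_exists_le_of_exists_ge P.continuous_angle_right ⟨0, ?_⟩ ⟨r, ?_⟩
  · have h1 := P.angle_zero_right_lt
    have h2 := P.le_rightAngle
    have h3 : 0 ≤ (j : ℝ) * π := by positivity
    linarith
  · rw [hk]
    gcongr

/-- By strict monotonicity in `r`, the eigenvalues below `r` correspond one to one to the levels `j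
< k`, all of which are attained. -/
theorem encard_eigenvalues_lt {r : ℝ} {k : ℕ} (hk : P.angle r P.β = P.rightAngle + k * π) :
    {s : ℝ | P.IsEigenvalue s ∧ s < r}.encard = k := by
  choose! g hg using fun (j : ℕ) (hj : j < k) => exists_angle_right_eq hk hj
  have heq : {s : ℝ | P.IsEigenvalue s ∧ s < r} = g '' (Finset.range k : Set ℕ) := by
    ext s
    simp only [mem_ofPred_eq, mem_image, Finset.coe_range, mem_Iio, isEigenvalue_iff]
    constructor
    · rintro ⟨⟨j, hj⟩, hs⟩
      have h1 : P.angle s P.β < P.angle r P.β := P.strictMono_angle_right hs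
      have h2 : j < k := by
        rw [hj, hk] at h1
        have : (j : ℝ) * π < k * π := by linarith
        exact_mod_cast lt_of_mul_lt_mul_right this pi_pos.le
      refine ⟨j, h2, P.strictMono_angle_right.injective ?_⟩
      exact (hg j h2).trans hj.symm
    · rintro ⟨j, hj, rfl⟩
      refine ⟨⟨j, hg j hj⟩, P.strictMono_angle_right.lt_iff_lt.1 ?_⟩
      simp only [hg j hj, hk]
      gcongr
  have hinj : InjOn g (Finset.range k : Set ℕ) := by
    intro i hi j hj hij
    have h1 := hg i (by simpa using hi)
    rw [hij, hg j (by simpa using hj)] at h1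
    have : (j : ℝ) = i := mul_right_cancel₀ pi_pos.ne' (add_left_cancel h1)
    exact_mod_cast this.symm
  rw [heq, hinj.encard_image, Set.encard_coe_eq_coe_finsetCard, Finset.card_range]

theorem IsNthEigenvalue.angle_right {r : ℝ} {j : ℕ} (h : P.IsNthEigenvalue j r) :
    P.angle r P.β = P.rightAngle + (j - 1 : ℕ) * π := by
  obtain ⟨k, hk⟩ := isEigenvalue_iff.1 h.1
  have h2 := h.2
  rw [encard_eigenvalues_lt hk] at h2
  have : k + 1 = j := by exact_mod_cast h2
  rw [hk, ← this, Nat.add_sub_cancel]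

/-! ### Zeros and sign changes of an eigenfunction -/

namespace IsEigenfunction

variable {r : ℝ} {V : ℝ → ℝ}

theorem eq_zero_iff (e : P.IsEigenfunction r V) {x : ℝ} (hx : x ∈ Icc P.α P.β) :
    V x = 0 ↔ ∃ n : ℤ, n * π = P.angle r x := by
  obtain ⟨c, hc, h⟩ := e.exists_eq_shoot
  rw [← sin_eq_zero_iff, (h x hx).1, shoot]
  simp [hc, (P.amplitude_pos r x).ne']

/-- At an interior zero the angle is `n π`. It lies strictly between `0` and `(k + 1) π`, so `1 ≤ n
≤ k`, and no `n` occurs twice. -/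
theorem card_zeros_le (e : P.IsEigenfunction r V) {k : ℕ}
    (hk : P.angle r P.β = P.rightAngle + k * π) (s : Finset ℝ) (hs : (s : Set ℝ) ⊆ Ioo P.α P.β)
    (h0 : ∀ x ∈ s, V x = 0) : s.card ≤ k := by
  have hex : ∀ x ∈ s, ∃ n : ℤ, n * π = P.angle r x := fun x hx =>
    (e.eq_zero_iff (Ioo_subset_Icc_self (hs hx))).1 (h0 x hx)
  choose! n hn using hex
  have hmaps : ∀ x ∈ s, n x ∈ Finset.Icc (1 : ℤ) k := by
    intro x hx
    have hxI := hs hx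
    have h1 := P.angle_pos (r := r) (Ioo_subset_Ioc_self hxI)
    have h2 := P.int_mul_pi_lt_angle (Ioo_subset_Icc_self hxI) P.right_mem hxI.2 (hn x hx).le
    rw [← hn x hx] at h1
    have h3 : (0 : ℝ) < n x := pos_of_mul_pos_left h1 pi_pos.le
    have h4 : ((n x : ℝ)) * π < (k + 1) * π := by linarith [P.rightAngle_le]
    have h5 : (n x : ℝ) < k + 1 := lt_of_mul_lt_mul_right h4 pi_pos.le
    have h3' : 0 < n x := by exact_mod_cast h3
    have h5' : n x < k + 1 := by exact_mod_cast h5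
    rw [Finset.mem_Icc]
    omega
  have hinj : InjOn n s := by
    intro x hx y hy hxy
    by_contra hne
    rcases lt_or_gt_of_ne hne with h | h
    · have := P.int_mul_pi_lt_angle (Ioo_subset_Icc_self (hs hx)) (Ioo_subset_Icc_self (hs hy)) h
        (hn x hx).le
      rw [hxy, hn y hy] at this
      exact this.false
    · have := P.int_mul_pi_lt_angle (Ioo_subset_Icc_self (hs hy)) (Ioo_subset_Icc_self (hs hx)) h
        (hn y hy).le
      rw [← hxy, hn x hx] at this
      exact this.false
  simpa using Finset.card_le_card_of_injOn n hmaps hinj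

theorem exists_alternating (e : P.IsEigenfunction r V) {k : ℕ}
    (hk : P.angle r P.β = P.rightAngle + k * π) :
    ∃ x : ℕ → ℝ, (∀ i ≤ k, x i ∈ Ioo P.α P.β) ∧
      ∀ i < k, x i < x (i + 1) ∧ V (x i) * V (x (i + 1)) < 0 := by
  rcases Nat.eq_zero_or_pos k with rfl | hkpos
  · obtain ⟨x, hx⟩ := exists_between P.lt
    exact ⟨fun _ => x, fun _ _ => hx, by simp⟩
  have hπ := pi_pos
  obtain ⟨c, hc, h⟩ := e.exists_eq_shoot
  have hex : ∀ i : ℕ, i ≤ k → ∃ x ∈ Ioo P.α P.β, i * π < P.angle r x ∧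
      P.angle r x < (i + 1) * π := by
    intro i hi
    have hcont : ContinuousOn (P.angle r) (Icc P.α P.β) :=
      (P.continuousOn_angle r).mono P.Icc_subset_nbhd
    have hivt := intermediate_value_Ioo P.lt.le hcont
    have hleft := P.leftAngle_le
    have hright := P.le_rightAngle
    rw [angle_left, hk] at hivt
    have hkR : (1 : ℝ) ≤ k := by exact_mod_cast hkpos
    have hiR : (i : ℝ) ≤ k := by exact_mod_cast hi
    rcases Nat.eq_zero_or_pos i with rfl | hipos
    · obtain ⟨x, hx, hxe⟩ := hivt (show 3 * π / 4 ∈ _ from ⟨by linarith, by nlinarith⟩)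
      exact ⟨x, hx, by rw [hxe]; push_cast; constructor <;> linarith⟩
    · have hi1 : (1 : ℝ) ≤ i := by exact_mod_cast hipos
      -- The initial angle can be as large as `π / 2`, hence `3 π / 4` for `i = 0`. This value is
      -- below the final angle because `k ≥ 1`, which is why `k = 0` was set apart.
      obtain ⟨x, hx, hxe⟩ := hivt (show i * π + π / 4 ∈ _ from ⟨by nlinarith, by nlinarith⟩)
      exact ⟨x, hx, by rw [hxe]; constructor <;> linarith⟩
  choose! x hx hx1 hx2 using hex
  have hsin : ∀ i ≤ k, 0 < (-1) ^ i * sin (P.angle r (x i)) := by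
    intro i hi
    have h1 := hx1 i hi
    have h2 := hx2 i hi
    rw [← sin_sub_nat_mul_pi]
    exact sin_pos_of_pos_of_lt_pi (by linarith) (by linarith)
  refine ⟨x, hx, fun i hi => ⟨?_, ?_⟩⟩
  · by_contra! hle
    have h1 := hx1 (i + 1) hi
    have h2 := hx2 i hi.le
    have hi1 := Ioo_subset_Icc_self (hx i hi.le)
    have hi2 := Ioo_subset_Icc_self (hx (i + 1) hi)
    rcases hle.lt_or_eq with hlt | heq
    · have := P.int_mul_pi_lt_angle (r := r) (k := (i + 1 : ℕ)) hi2 hi1 hlt (by exact_mod_cast h1.le)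
      push_cast at this
      linarith
    · rw [heq] at h1
      push_cast at h1
      linarith
  · rw [(h _ (Ioo_subset_Icc_self (hx i hi.le))).1, (h _ (Ioo_subset_Icc_self (hx (i + 1) hi))).1,
      shoot, shoot]
    have h1 := mul_pos (hsin i hi.le) (hsin (i + 1) hi)
    have h2 : ((-1 : ℝ) ^ i) * (-1) ^ i = 1 := by rw [← mul_pow]; simp
    have h3 : sin (P.angle r (x i)) * sin (P.angle r (x (i + 1))) < 0 := by
      rw [pow_succ] at h1
      have : (-1 : ℝ) ^ i * sin (P.angle r (x i)) *
          ((-1) ^ i * -1 * sin (P.angle r (x (i + 1)))) =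
          -(sin (P.angle r (x i)) * sin (P.angle r (x (i + 1)))) := by
        linear_combination -(sin (P.angle r (x i)) * sin (P.angle r (x (i + 1)))) * h2
      linarith
    have h4 : 0 < c ^ 2 * P.amplitude r (x i) * P.amplitude r (x (i + 1)) :=
      mul_pos (mul_pos (by positivity) (P.amplitude_pos _ _)) (P.amplitude_pos _ _)
    nlinarith [mul_neg_of_pos_of_neg h4 h3]

end IsEigenfunction

end SturmLiouvilleProblem

theorem hasZeroCount_of_alternating {f : ℝ → ℝ} {a b : ℝ} (hf : ContinuousOn f (Ioo a b))
    {x : ℕ → ℝ} {k : ℕ} (hx : ∀ i ≤ k, x i ∈ Ioo a b)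
    (hlt : ∀ i < k, x i < x (i + 1) ∧ f (x i) * f (x (i + 1)) < 0) : HasZeroCount f a b k := by
  suffices h : ∃ s : Finset ℝ, (s : Set ℝ) ⊆ Ioo a (x k) ∧ s.card = k ∧ ∀ ξ ∈ s, f ξ = 0 by
    obtain ⟨s, hs, hcard, h0⟩ := h
    refine ⟨s, fun _ => 1, hs.trans (Ioo_subset_Ioo_right (hx k le_rfl).2.le), ?_, ?_⟩
    · exact fun ξ hξ => VanishesToOrder.one_iff.2 (h0 ξ hξ)
    · simp [hcard]
  induction k with
  | zero => exact ⟨∅, by simp⟩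
  | succ k ih =>
    obtain ⟨s, hs, hcard, h0⟩ := ih (fun i hi => hx i (by omega)) (fun i hi => hlt i (by omega))
    obtain ⟨hk, hsign⟩ := hlt k (by omega)
    have hsub : Icc (x k) (x (k + 1)) ⊆ Ioo a b :=
      ordConnected_Ioo.out (hx k (by omega)) (hx (k + 1) le_rfl)
    have hc := hf.mono hsub
    obtain ⟨z, hz, hz0⟩ : ∃ z ∈ Ioo (x k) (x (k + 1)), f z = 0 := by
      rcases mul_neg_iff.1 hsign with h | h
      · exact intermediate_value_Ioo' hk.le hc ⟨h.2, h.1⟩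
      · exact intermediate_value_Ioo hk.le hc ⟨h.1, h.2⟩
    have hzs : z ∉ s := fun h => absurd (hs h).2 (not_lt.2 hz.1.le)
    refine ⟨insert z s, ?_, by rw [Finset.card_insert_of_notMem hzs, hcard], ?_⟩
    · intro y hy
      rcases Finset.mem_insert.1 hy with rfl | hy
      · exact ⟨(hx k (by omega)).1.trans hz.1, hz.2⟩
      · exact ⟨(hs hy).1, (hs hy).2.trans hk⟩
    · intro y hy
      rcases Finset.mem_insert.1 hy with rfl | hy
      · exact hz0
      · exact h0 y hy

theorem HasZeroCount.const_mul {f : ℝ → ℝ} {a b : ℝ} {N : ℕ} (h : HasZeroCount f a b N)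
    (hf : ContDiffOn ℝ ∞ f (Ioo a b)) (c : ℝ) : HasZeroCount (fun x => c * f x) a b N :=
  (h.mul hf (contDiffOn_const (c := c))).congr fun _ _ => mul_comm _ _

/-! ### Liouville's transformation of linear combinations -/

namespace SturmLiouvilleProblem

variable {P : SturmLiouvilleProblem}

theorem Ioo_subset (P : SturmLiouvilleProblem) : Ioo P.α P.β ⊆ Ioo P.α₀ P.β₀ :=
  Ioo_subset_Icc_self.trans (P.Icc_subset_nbhd.trans P.nbhd_subset)

namespace IsEigenfunction

variable {r s : ℝ} {V W : ℝ → ℝ}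

/-- Bootstrap on the first-order system `V' = (K V') / K`, `(K V')' = -(r G - L) V`. Multiplicities
involve all derivatives, while eigenfunctions are only assumed `C²`. -/
theorem contDiffOn_nat (e : P.IsEigenfunction r V) (n : ℕ) :
    ContDiffOn ℝ n V (Ioo P.α P.β) ∧ ContDiffOn ℝ n (P.flux V) (Ioo P.α P.β) := by
  induction n with
  | zero =>
    simp only [Nat.cast_zero, contDiffOn_zero]
    exact ⟨e.continuousOn.mono Ioo_subset_Icc_self, e.continuousOn_flux.mono Ioo_subset_Icc_self⟩
  | succ n ih =>
    have hn : ((n : ℕ∞) : WithTop ℕ∞) ≤ ((⊤ : ℕ∞) : WithTop ℕ∞) := by exact_mod_cast le_top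
    have hK : ContDiffOn ℝ n (fun x => (P.K x)⁻¹) (Ioo P.α P.β) :=
      ((P.K_smooth.of_le hn).mono P.Ioo_subset).inv fun x hx => (P.K_pos x (P.Ioo_subset hx)).ne'
    have hq : ContDiffOn ℝ n (P.potential r) (Ioo P.α P.β) :=
      (contDiffOn_const.mul ((P.G_smooth.of_le hn).mono P.Ioo_subset)).sub
        ((P.L_smooth.of_le hn).mono P.Ioo_subset)
    rw [Nat.cast_add, Nat.cast_one, contDiffOn_succ_iff_deriv_of_isOpen isOpen_Ioo,
      contDiffOn_succ_iff_deriv_of_isOpen isOpen_Ioo]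
    refine ⟨⟨fun x hx => (e.hasDerivAt hx).differentiableAt.differentiableWithinAt, by simp, ?_⟩,
      fun x hx => (e.hasDerivAt_flux hx).differentiableAt.differentiableWithinAt, by simp, ?_⟩
    · refine (hK.mul ih.2).congr fun x hx => ?_
      rw [(e.hasDerivAt hx).deriv, derivWithin_eq_inv_mul_flux V (Ioo_subset_Icc_self hx)]
    · exact (hq.mul ih.1).neg.congr fun x hx => (e.hasDerivAt_flux hx).deriv

theorem contDiffOn_infty (e : P.IsEigenfunction r V) : ContDiffOn ℝ ∞ V (Ioo P.α P.β) :=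
  _root_.contDiffOn_infty.2 fun n => (e.contDiffOn_nat n).1

/-- Both vectors `(V, K V')` are orthogonal at `α` to the same nonzero vector `(cos γ, -sin γ)`,
whatever the eigenvalues. -/
theorem wronskian_left (e : P.IsEigenfunction r V) (e' : P.IsEigenfunction s W) :
    P.flux V P.α * W P.α - V P.α * P.flux W P.α = 0 := by
  have h1 := (P.leftBoundary_iff V).1 e.left_boundary
  have h2 := (P.leftBoundary_iff W).1 e'.left_boundary
  change V P.α * _ - P.flux V P.α * _ = 0 at h1
  change W P.α * _ - P.flux W P.α * _ = 0 at h2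
  have h3 := Real.sin_sq_add_cos_sq P.leftAngle
  generalize P.flux V P.α = p at *
  generalize P.flux W P.α = q at *
  generalize V P.α = v at *
  generalize W P.α = w at *
  grind

theorem wronskian_right (e : P.IsEigenfunction r V) (e' : P.IsEigenfunction s W) :
    P.flux V P.β * W P.β - V P.β * P.flux W P.β = 0 := by
  have h1 := (P.rightBoundary_iff V).1 e.right_boundary
  have h2 := (P.rightBoundary_iff W).1 e'.right_boundary
  change V P.β * _ - P.flux V P.β * _ = 0 at h1
  change W P.β * _ - P.flux W P.β * _ = 0 at h2
  have h3 := Real.sin_sq_add_cos_sq P.rightAngle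
  generalize P.flux V P.β = p at *
  generalize P.flux W P.β = q at *
  generalize V P.β = v at *
  generalize W P.β = w at *
  grind

/-- Vanishing at an endpoint is thus shared by all eigenfunctions; this controls zeros that approach
the boundary in the limit argument. -/
theorem eq_zero_left (e : P.IsEigenfunction r V) (e' : P.IsEigenfunction s W) (h : V P.α = 0) :
    W P.α = 0 := by
  have := e.wronskian_left e'
  simpa [h, e.flux_ne_zero P.left_mem h] using this

theorem eq_zero_right (e : P.IsEigenfunction r V) (e' : P.IsEigenfunction s W) (h : V P.β = 0) :
    W P.β = 0 := by
  have := e.wronskian_right e'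
  simpa [h, e.flux_ne_zero P.right_mem h] using this

end IsEigenfunction

section Combination

variable {J : Finset ℕ} {ρ : ℕ → ℝ} {V : ℕ → ℝ → ℝ} {σ : ℝ} {W : ℝ → ℝ}

theorem contDiffOn_comb (hV : ∀ j ∈ J, P.IsEigenfunction (ρ j) (V j)) (A : ℕ → ℝ) :
    ContDiffOn ℝ ∞ (fun x => ∑ j ∈ J, A j * V j x) (Ioo P.α P.β) :=
  ContDiffOn.sum fun j hj => contDiffOn_const.mul (hV j hj).contDiffOn_infty

theorem hasDerivAt_comb (hV : ∀ j ∈ J, P.IsEigenfunction (ρ j) (V j)) (A : ℕ → ℝ) {x : ℝ}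
    (hx : x ∈ Ioo P.α P.β) : HasDerivAt (fun x => ∑ j ∈ J, A j * V j x)
      (∑ j ∈ J, A j * derivWithin (V j) (Icc P.α P.β) x) x :=
  HasDerivAt.fun_sum fun j hj => ((hV j hj).hasDerivAt hx).const_mul (A j)

/-- Multiplying the coefficients by `ρ j - σ`, where `σ` is an eigenvalue with an eigenfunction
free of zeros, does not decrease the number of zeros. -/
theorem hasZeroCount_liouville (hV : ∀ j ∈ J, P.IsEigenfunction (ρ j) (V j))
    (hW : P.IsEigenfunction σ W) (hW0 : ∀ x ∈ Ioo P.α P.β, W x ≠ 0) {A : ℕ → ℝ} {N : ℕ}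
    (h : HasZeroCount (fun x => ∑ j ∈ J, A j * V j x) P.α P.β N) :
    HasZeroCount (fun x => ∑ j ∈ J, (ρ j - σ) * A j * V j x) P.α P.β N := by
  obtain _ | M := N
  · exact ⟨∅, fun _ => 0, by simp⟩
  have hYs := contDiffOn_comb hV A
  have hWs := hW.contDiffOn_infty
  have hWis : ContDiffOn ℝ ∞ (fun x => (W x)⁻¹) (Ioo P.α P.β) := hWs.inv hW0
  have hFs := hYs.mul hWis
  have h1 := (h.mul hYs hWis).deriv hFs.continuousOn
  have hKs : ContDiffOn ℝ ∞ (fun x => P.K x * W x ^ 2) (Ioo P.α P.β) :=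
    (P.K_smooth.mono P.Ioo_subset).mul (hWs.pow 2)
  -- In the interior `Q = K W² (Y / W)'`. Unlike the quotient, `Q` is continuous up to the endpoints
  -- even when `W` vanishes there.
  set Q : ℝ → ℝ := fun x => ∑ j ∈ J, A j * (P.flux (V j) x * W x - V j x * P.flux W x)
  have h2 : HasZeroCount Q P.α P.β M := by
    refine (h1.mul ((contDiffOn_infty_iff_deriv_of_isOpen isOpen_Ioo).1 hFs).2 hKs).congr ?_
    intro x hx
    have hWx := hW0 x hx
    have hd := (hasDerivAt_comb hV A hx).mul ((hW.hasDerivAt hx).inv hWx)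
    simp only [Pi.mul_apply]
    erw [hd.deriv]
    simp only [Q, flux, Pi.inv_apply]
    simp only [mul_sub, Finset.sum_sub_distrib]
    have e1 : ∑ j ∈ J, A j * (P.K x * derivWithin (V j) (Icc P.α P.β) x * W x) =
        (∑ j ∈ J, A j * derivWithin (V j) (Icc P.α P.β) x) * (P.K x * W x) := by
      rw [Finset.sum_mul]; exact Finset.sum_congr rfl fun j _ => by ring
    have e2 : ∑ j ∈ J, A j * (V j x * (P.K x * derivWithin W (Icc P.α P.β) x)) =
        (∑ j ∈ J, A j * V j x) * (P.K x * derivWithin W (Icc P.α P.β) x) := by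
      rw [Finset.sum_mul]; exact Finset.sum_congr rfl fun j _ => by ring
    rw [e1, e2]
    field_simp
    ring
  have hQc : ContinuousOn Q (Icc P.α P.β) :=
    continuousOn_finsetSum _ fun j hj => continuousOn_const.mul
      (((hV j hj).continuousOn_flux.mul hW.continuousOn).sub
        ((hV j hj).continuousOn.mul hW.continuousOn_flux))
  -- The two endpoint zeros of `Q` restore the zero lost in passing to `(Y / W)'`.
  have h3 := h2.deriv_of_endpoints P.lt hQc
    (Finset.sum_eq_zero fun j hj => by rw [(hV j hj).wronskian_left hW, mul_zero])
    (Finset.sum_eq_zero fun j hj => by rw [(hV j hj).wronskian_right hW, mul_zero])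
  have hY1s := contDiffOn_comb hV fun j => (ρ j - σ) * A j
  have hGs : ContDiffOn ℝ ∞ (fun x => P.G x * W x) (Ioo P.α P.β) :=
    (P.G_smooth.mono P.Ioo_subset).mul hWs
  have hG0 : ∀ x ∈ Ioo P.α P.β, P.G x * W x ≠ 0 := fun x hx =>
    mul_ne_zero (P.G_pos x (P.Ioo_subset hx)).ne' (hW0 x hx)
  -- The products of first derivatives and the terms in `L` cancel; only `(ρ j - σ) G` survives.
  have hQ' : EqOn (deriv Q)
      (fun x => -((P.G x * W x) * ∑ j ∈ J, (ρ j - σ) * A j * V j x)) (Ioo P.α P.β) := by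
    intro x hx
    have hd : HasDerivAt Q (∑ j ∈ J, A j * (-(P.potential (ρ j) x * V j x) * W x +
        P.flux (V j) x * derivWithin W (Icc P.α P.β) x -
        (derivWithin (V j) (Icc P.α P.β) x * P.flux W x +
          V j x * -(P.potential σ x * W x)))) x :=
      HasDerivAt.fun_sum fun j hj => HasDerivAt.const_mul (A j)
        ((((hV j hj).hasDerivAt_flux hx).mul (hW.hasDerivAt hx)).sub
          (((hV j hj).hasDerivAt hx).mul (hW.hasDerivAt_flux hx)))
    simp only
    rw [hd.deriv, Finset.mul_sum, ← Finset.sum_neg_distrib]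
    refine Finset.sum_congr rfl fun j _ => ?_
    simp only [flux, potential]
    ring
  have hQ's : ContDiffOn ℝ ∞ (deriv Q) (Ioo P.α P.β) := (hGs.mul hY1s).neg.congr hQ'
  refine (h3.mul hQ's (g := fun x => -(P.G x * W x)⁻¹) (hGs.inv hG0).neg).congr fun x hx => ?_
  simp only [Pi.mul_apply]
  rw [hQ' hx, neg_mul_neg, mul_comm (P.G x * W x), mul_inv_cancel_right₀ (hG0 x hx)]

theorem hasZeroCount_liouville_pow (hV : ∀ j ∈ J, P.IsEigenfunction (ρ j) (V j))
    (hW : P.IsEigenfunction σ W) (hW0 : ∀ x ∈ Ioo P.α P.β, W x ≠ 0) {A : ℕ → ℝ} {N : ℕ}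
    (h : HasZeroCount (fun x => ∑ j ∈ J, A j * V j x) P.α P.β N) (l : ℕ) :
    HasZeroCount (fun x => ∑ j ∈ J, (ρ j - σ) ^ l * A j * V j x) P.α P.β N := by
  induction l with
  | zero => simpa using h
  | succ l ih =>
    refine (hasZeroCount_liouville hV hW hW0 ih).congr fun x _ => ?_
    exact Finset.sum_congr rfl fun j _ => by rw [pow_succ]; ring

/-! ### Limits of combinations dominated by one eigenfunction -/

theorem tendsto_comb {F : ℕ → ℝ → ℝ} {S : Set ℝ} (hF : ∀ j ∈ J, ContinuousOn (F j) S)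
    {U : Filter ℕ} {B : ℕ → ℕ → ℝ} {n : ℕ} {c : ℝ} (hn : n ∈ J)
    (hB : ∀ j ∈ J, Tendsto (fun l => B l j) U (𝓝 (if j = n then c else 0)))
    {x : ℕ → ℝ} {a : ℝ} (hxS : ∀ᶠ l in U, x l ∈ S) (ha : a ∈ S) (hx : Tendsto x U (𝓝 a)) :
    Tendsto (fun l => ∑ j ∈ J, B l j * F j (x l)) U (𝓝 (c * F n a)) := by
  have hx' : Tendsto x U (𝓝[S] a) := tendsto_nhdsWithin_iff.2 ⟨hx, hxS⟩
  have := tendsto_finsetSum J fun j hj => (hB j hj).mul ((hF j hj a ha).tendsto.comp hx')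
  simpa [hn] using this

/-- A combination dominated by `V n` has at least as many zeros as `V n`. -/
theorem exists_hasZeroCount_of_tendsto (hV : ∀ j ∈ J, P.IsEigenfunction (ρ j) (V j))
    {B : ℕ → ℕ → ℝ} {n k : ℕ} {c : ℝ} (hn : n ∈ J) (hc : c ≠ 0)
    (hB : ∀ j ∈ J, Tendsto (fun l => B l j) atTop (𝓝 (if j = n then c else 0)))
    (hk : P.angle (ρ n) P.β = P.rightAngle + k * Real.pi) :
    ∃ l, HasZeroCount (fun x => ∑ j ∈ J, B l j * V j x) P.α P.β k := by
  obtain ⟨x, hx, hlt⟩ := (hV n hn).exists_alternating hk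
  have hlim : ∀ i ≤ k, Tendsto (fun l => ∑ j ∈ J, B l j * V j (x i)) atTop (𝓝 (c * V n (x i))) :=
    fun i hi => tendsto_comb (x := fun _ => x i) (fun j hj => (hV j hj).continuousOn) hn hB
      (Eventually.of_forall fun _ => Ioo_subset_Icc_self (hx i hi)) (Ioo_subset_Icc_self (hx i hi))
      tendsto_const_nhds
  have hev : ∀ᶠ l in atTop, ∀ i ∈ Finset.range k,
      (∑ j ∈ J, B l j * V j (x i)) * (∑ j ∈ J, B l j * V j (x (i + 1))) < 0 := by
    rw [eventually_all_finset]
    intro i hi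
    have hi := Finset.mem_range.1 hi
    refine ((hlim i hi.le).mul (hlim (i + 1) hi)).eventually (gt_mem_nhds ?_)
    have h1 := (hlt i hi).2
    have h2 : 0 < c ^ 2 := by positivity
    nlinarith [mul_neg_of_pos_of_neg h2 h1]
  obtain ⟨l, hl⟩ := hev.exists
  exact ⟨l, hasZeroCount_of_alternating (contDiffOn_comb hV (B l)).continuousOn hx
    fun i hi => ⟨(hlt i hi).1, hl i (Finset.mem_range.2 hi)⟩⟩

theorem exists_tendsto_Icc (P : SturmLiouvilleProblem) (U : Ultrafilter ℕ) {x : ℕ → ℝ}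
    (hx : ∀ᶠ l in U, x l ∈ Icc P.α P.β) : ∃ a ∈ Icc P.α P.β, Tendsto x U (𝓝 a) := by
  obtain ⟨a, ha, h⟩ := (isCompact_Icc (a := P.α) (b := P.β)).ultrafilter_le_nhds (U.map x)
    (le_principal_iff.2 hx)
  exact ⟨a, ha, h⟩

/-- Between two zeros merging at `a`, Rolle gives a zero of the derivative, which also tends to `a`.
The point `a` may be an endpoint, hence the one-sided derivative. -/
theorem derivWithin_eq_zero_of_double_zero (hV : ∀ j ∈ J, P.IsEigenfunction (ρ j) (V j))
    {U : Ultrafilter ℕ} {B : ℕ → ℕ → ℝ} {n : ℕ} {c : ℝ} (hn : n ∈ J) (hc : c ≠ 0)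
    (hB : ∀ j ∈ J, Tendsto (fun l => B l j) U (𝓝 (if j = n then c else 0)))
    {y z : ℕ → ℝ} {a : ℝ} (ha : a ∈ Icc P.α P.β) (hy : Tendsto y U (𝓝 a)) (hz : Tendsto z U (𝓝 a))
    (h : ∀ᶠ l in U, y l ≠ z l ∧ y l ∈ Icc P.α P.β ∧ z l ∈ Icc P.α P.β ∧
      ∑ j ∈ J, B l j * V j (y l) = 0 ∧ ∑ j ∈ J, B l j * V j (z l) = 0) :
    derivWithin (V n) (Icc P.α P.β) a = 0 := by
  have hex : ∀ᶠ l in U, ∃ ζ, ζ ∈ Icc (min (y l) (z l)) (max (y l) (z l)) ∧ ζ ∈ Icc P.α P.β ∧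
      ∑ j ∈ J, B l j * derivWithin (V j) (Icc P.α P.β) ζ = 0 := by
    filter_upwards [h] with l hl
    obtain ⟨hne, hyI, hzI, hy0, hz0⟩ := hl
    have hlt : min (y l) (z l) < max (y l) (z l) := min_lt_max.2 hne
    have hsub : Icc (min (y l) (z l)) (max (y l) (z l)) ⊆ Icc P.α P.β :=
      Icc_subset_Icc (le_min hyI.1 hzI.1) (max_le hyI.2 hzI.2)
    have hcont : ContinuousOn (fun x => ∑ j ∈ J, B l j * V j x) (Icc P.α P.β) :=
      continuousOn_finsetSum _ fun j hj => continuousOn_const.mul (hV j hj).continuousOn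
    obtain ⟨ζ, hζ, hζ0⟩ := exists_hasDerivAt_eq_zero hlt (hcont.mono hsub)
      (by rcases le_total (y l) (z l) with h | h <;> simp [h, hy0, hz0])
      (fun x hx => hasDerivAt_comb hV (B l)
        ⟨(hsub (left_mem_Icc.2 hlt.le)).1.trans_lt hx.1,
          hx.2.trans_le (hsub (right_mem_Icc.2 hlt.le)).2⟩)
    exact ⟨ζ, Ioo_subset_Icc_self hζ, hsub (Ioo_subset_Icc_self hζ), hζ0⟩
  obtain ⟨ζ, hζ⟩ := hex.choice
  have hlim : Tendsto ζ U (𝓝 a) := by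
    refine tendsto_of_tendsto_of_tendsto_of_le_of_le' (g := fun l => min (y l) (z l))
      (h := fun l => max (y l) (z l)) ?_ ?_ (hζ.mono fun l hl => hl.1.1) (hζ.mono fun l hl => hl.1.2)
    · simpa using hy.min hz
    · simpa using hy.max hz
  have h1 := tendsto_comb (F := fun j => derivWithin (V j) (Icc P.α P.β))
    (fun j hj => (hV j hj).contDiffOn_derivWithin.continuousOn) hn hB
    (hζ.mono fun l hl => hl.2.1) ha hlim
  have h2 := tendsto_nhds_unique (h1.congr' (hζ.mono fun l hl => hl.2.2)) tendsto_const_nhds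
  simpa [hc] using h2

/-- A combination dominated by `V n` has at most as many zeros as `V n`. -/
theorem exists_not_hasZeroCount_of_tendsto (hV : ∀ j ∈ J, P.IsEigenfunction (ρ j) (V j))
    {B : ℕ → ℕ → ℝ} {n k : ℕ} {c : ℝ} (hn : n ∈ J) (hc : c ≠ 0)
    (hB : ∀ j ∈ J, Tendsto (fun l => B l j) atTop (𝓝 (if j = n then c else 0)))
    (hk : P.angle (ρ n) P.β = P.rightAngle + k * Real.pi) :
    ∃ l, ¬ HasZeroCount (fun x => ∑ j ∈ J, B l j * V j x) P.α P.β (k + 1) := by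
  by_contra! hall
  -- An ultrafilter replaces repeated extraction of subsequences: it selects one of the two cases
  -- below, and every sequence in `[α, β]` converges along it.
  set U : Ultrafilter ℕ := hyperfilter ℕ
  have hU : (U : Filter ℕ) ≤ atTop := Nat.hyperfilter_le_atTop
  replace hB : ∀ j ∈ J, Tendsto (fun l => B l j) U (𝓝 (if j = n then c else 0)) :=
    fun j hj => (hB j hj).mono_left hU
  have hzero : ∀ {x : ℕ → ℝ} {a : ℝ}, (∀ᶠ l in U, x l ∈ Icc P.α P.β) → a ∈ Icc P.α P.β →
      Tendsto x U (𝓝 a) → (∀ᶠ l in U, ∑ j ∈ J, B l j * V j (x l) = 0) → V n a = 0 := by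
    intro x a hx ha hlim h0
    have h1 := tendsto_comb (fun j hj => (hV j hj).continuousOn) hn hB hx ha hlim
    simpa [hc] using tendsto_nhds_unique (h1.congr' h0) tendsto_const_nhds
  -- Having `k + 1` zeros with multiplicity means a multiple zero or `k + 1` distinct ones. A
  -- multiple zero would tend to a point where `V n` and its derivative both vanish.
  have hcases : ∀ l, (∃ x ∈ Ioo P.α P.β, ∑ j ∈ J, B l j * V j x = 0 ∧
        ∑ j ∈ J, B l j * derivWithin (V j) (Icc P.α P.β) x = 0) ∨
      ∃ x : Fin (k + 1) → ℝ, Function.Injective x ∧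
        ∀ i, x i ∈ Ioo P.α P.β ∧ ∑ j ∈ J, B l j * V j (x i) = 0 := by
    intro l
    obtain ⟨s, μ, hs, hμ, hpos, hsum⟩ := (hall l).exists_pos
    by_cases h2 : ∃ ξ ∈ s, 2 ≤ μ ξ
    · obtain ⟨ξ, hξ, h2⟩ := h2
      refine Or.inl ⟨ξ, hs hξ, (hμ ξ hξ).apply_eq_zero (hpos ξ hξ), ?_⟩
      rw [← (hasDerivAt_comb hV (B l) (hs hξ)).deriv]
      exact (hμ ξ hξ).deriv_eq_zero h2
    · push Not at h2
      have hcard : k + 1 ≤ s.card := by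
        refine hsum.trans ?_
        rw [Finset.card_eq_sum_ones]
        exact Finset.sum_le_sum fun ξ hξ => Nat.lt_succ_iff.1 (h2 ξ hξ)
      obtain ⟨t, hts, htc⟩ := Finset.exists_subset_card_eq hcard
      refine Or.inr ⟨t.orderEmbOfFin htc, (t.orderEmbOfFin htc).injective, fun i => ?_⟩
      have hm := hts (t.orderEmbOfFin_mem htc i)
      exact ⟨hs hm, (hμ _ hm).apply_eq_zero (hpos _ hm)⟩
  rcases Ultrafilter.eventually_or.1 (Eventually.of_forall hcases : ∀ᶠ l in U, _) with hcase | hcase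
  · obtain ⟨x, hx⟩ := hcase.choice
    have hxI : ∀ᶠ l in U, x l ∈ Icc P.α P.β := hx.mono fun l hl => Ioo_subset_Icc_self hl.1
    obtain ⟨a, ha, hlim⟩ := P.exists_tendsto_Icc U hxI
    have h0 := hzero hxI ha hlim (hx.mono fun l hl => hl.2.1)
    have h1 := tendsto_comb (F := fun j => derivWithin (V j) (Icc P.α P.β))
      (fun j hj => (hV j hj).contDiffOn_derivWithin.continuousOn) hn hB hxI ha hlim
    have h2 := tendsto_nhds_unique (h1.congr' (hx.mono fun l hl => hl.2.2)) tendsto_const_nhds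
    exact (hV n hn).derivWithin_ne_zero ha h0 (by simpa [hc] using h2)
  · obtain ⟨x, hx⟩ := hcase.choice
    have hxI : ∀ i, ∀ᶠ l in U, x l i ∈ Icc P.α P.β := fun i =>
      hx.mono fun l hl => Ioo_subset_Icc_self (hl.2 i).1
    choose a ha hlim using fun i => P.exists_tendsto_Icc U (hxI i)
    have h0 : ∀ i, V n (a i) = 0 := fun i =>
      hzero (hxI i) (ha i) (hlim i) (hx.mono fun l hl => (hl.2 i).2)
    -- Two zeros with the same limit would give `V n` a double zero.
    have hinj : Function.Injective a := by
      intro i i' hii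
      by_contra hne
      refine (hV n hn).derivWithin_ne_zero (ha i) (h0 i)
        (derivWithin_eq_zero_of_double_zero hV hn hc hB (ha i) (hlim i) (hii ▸ hlim i') ?_)
      filter_upwards [hx] with l hl
      exact ⟨fun h => hne (hl.1 h), Ioo_subset_Icc_self (hl.2 i).1, Ioo_subset_Icc_self (hl.2 i').1,
        (hl.2 i).2, (hl.2 i').2⟩
    -- If a zero tended to an endpoint, every `V j` would vanish there, and the endpoint itself
    -- would serve as the second merging zero.
    have hmem : ∀ i, a i ∈ Ioo P.α P.β := by
      intro i
      refine ⟨lt_of_le_of_ne (ha i).1 fun h => ?_, lt_of_le_of_ne (ha i).2 fun h => ?_⟩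
      · refine (hV n hn).derivWithin_ne_zero (ha i) (h0 i)
          (derivWithin_eq_zero_of_double_zero hV hn hc hB (y := fun _ => P.α) (ha i)
            (h ▸ tendsto_const_nhds) (hlim i) ?_)
        filter_upwards [hx] with l hl
        refine ⟨(hl.2 i).1.1.ne, P.left_mem, Ioo_subset_Icc_self (hl.2 i).1, ?_, (hl.2 i).2⟩
        refine Finset.sum_eq_zero fun j hj => ?_
        rw [(hV n hn).eq_zero_left (hV j hj) (by rw [h]; exact h0 i), mul_zero]
      · refine (hV n hn).derivWithin_ne_zero (ha i) (h0 i)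
          (derivWithin_eq_zero_of_double_zero hV hn hc hB (y := fun _ => P.β) (ha i)
            (h ▸ tendsto_const_nhds) (hlim i) ?_)
        filter_upwards [hx] with l hl
        refine ⟨(hl.2 i).1.2.ne', P.right_mem, Ioo_subset_Icc_self (hl.2 i).1, ?_, (hl.2 i).2⟩
        refine Finset.sum_eq_zero fun j hj => ?_
        rw [(hV n hn).eq_zero_right (hV j hj) (by rw [← h]; exact h0 i), mul_zero]
    have hle := (hV n hn).card_zeros_le hk (Finset.univ.image a) (by simpa [range_subset_iff] using hmem)
      (by simpa using h0)
    rw [Finset.card_image_of_injective _ hinj] at hle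
    simp at hle

end Combination

/-! ### The ground state and the two bounds -/

theorem exists_ground_state {r : ℝ} {k : ℕ} (hk : P.angle r P.β = P.rightAngle + k * Real.pi)
    (hk0 : 0 < k) : ∃ (σ : ℝ) (W : ℝ → ℝ), P.IsEigenfunction σ W ∧
      (∀ x ∈ Ioo P.α P.β, W x ≠ 0) ∧ P.angle σ P.β = P.rightAngle := by
  obtain ⟨σ, hσ⟩ := exists_angle_right_eq hk hk0
  have e := isEigenfunction_shoot hσ
  refine ⟨σ, _, e, fun x hx h0 => ?_, by simpa using hσ⟩
  have := e.card_zeros_le hσ {x} (by simpa using hx) (by simpa using h0)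
  simp at this

theorem IsNthEigenvalue.lt {i j : ℕ} {r s : ℝ} (hi : P.IsNthEigenvalue i r)
    (hj : P.IsNthEigenvalue j s) (h1 : 1 ≤ i) (hij : i < j) : r < s := by
  refine P.strictMono_angle_right.lt_iff_lt.1 ?_
  simp only [hi.angle_right, hj.angle_right]
  have : i - 1 < j - 1 := by omega
  have := Real.pi_pos
  gcongr

theorem IsNthEigenvalue.le_of_angle_eq {j : ℕ} {r σ : ℝ} (hj : P.IsNthEigenvalue j r)
    (hσ : P.angle σ P.β = P.rightAngle) : σ ≤ r := by
  refine P.strictMono_angle_right.le_iff_le.1 ?_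
  simp only [hj.angle_right, hσ]
  have := Real.pi_pos
  have : 0 ≤ ((j - 1 : ℕ) : ℝ) * Real.pi := by positivity
  linarith

theorem IsNthEigenvalue.lt_of_angle_eq {j : ℕ} {r σ : ℝ} (hj : P.IsNthEigenvalue j r)
    (h2 : 2 ≤ j) (hσ : P.angle σ P.β = P.rightAngle) : σ < r := by
  refine P.strictMono_angle_right.lt_iff_lt.1 ?_
  simp only [hj.angle_right, hσ]
  have h : 0 < j - 1 := by omega
  have h : (0 : ℝ) < (j - 1 : ℕ) := by exact_mod_cast h
  have := mul_pos h Real.pi_pos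
  linarith

end SturmLiouvilleProblem

theorem tendsto_pow_mul_ite {q : ℕ → ℝ} {i j : ℕ} (hi : q i = 1) (hj : j ≠ i → |q j| < 1)
    (A : ℕ → ℝ) : Tendsto (fun l : ℕ => q j ^ l * A j) atTop (𝓝 (if j = i then A i else 0)) := by
  split_ifs with h
  · subst h
    simp [hi]
  · simpa using (tendsto_pow_atTop_nhds_zero_of_abs_lt_one (hj h)).mul_const (A j)

namespace SturmLiouvilleProblem

variable {P : SturmLiouvilleProblem} {m n : ℕ} {ρ : ℕ → ℝ} {V : ℕ → ℝ → ℝ} {A : ℕ → ℝ}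

/-- After division by `(ρ n - σ)^l` the forward iterates tend to `A n V n`, since `0 ≤ (ρ j - σ) /
(ρ n - σ) < 1` for `j < n`. All of them would inherit `n` zeros from the original combination. -/
theorem not_hasZeroCount_comb (hm : 1 ≤ m) (hmn : m ≤ n)
    (hρ : ∀ j ∈ Finset.Icc m n, P.IsNthEigenvalue j (ρ j))
    (hV : ∀ j ∈ Finset.Icc m n, P.IsEigenfunction (ρ j) (V j)) (hA : A n ≠ 0) :
    ¬ HasZeroCount (fun x => ∑ j ∈ Finset.Icc m n, A j * V j x) P.α P.β (n - 1 + 1) := by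
  have hn : n ∈ Finset.Icc m n := Finset.right_mem_Icc.2 hmn
  have hangle := (hρ n hn).angle_right
  intro h
  -- For `n = 1` the combination is a multiple of the first eigenfunction and `ρ n - σ` would be
  -- zero; the limit lemma is applied to a constant sequence.
  rcases Nat.lt_or_ge n 2 with h1 | h2
  · obtain ⟨l, hl⟩ := exists_not_hasZeroCount_of_tendsto (B := fun _ => A) hV hn hA (by
      intro j hj
      rw [Finset.mem_Icc] at hj
      obtain rfl : j = n := by omega
      simp) hangle
    exact hl h
  · obtain ⟨σ, W, hW, hW0, hσ⟩ := exists_ground_state hangle (by omega)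
    have hpos : 0 < ρ n - σ := sub_pos.2 ((hρ n hn).lt_of_angle_eq h2 hσ)
    obtain ⟨l, hl⟩ := exists_not_hasZeroCount_of_tendsto
      (B := fun l j => ((ρ j - σ) / (ρ n - σ)) ^ l * A j) hV hn hA (fun j hj => by
        refine tendsto_pow_mul_ite (q := fun j => (ρ j - σ) / (ρ n - σ)) (div_self hpos.ne')
          (fun hne => ?_) A
        rw [Finset.mem_Icc] at hj
        have h1 := (hρ j (Finset.mem_Icc.2 hj)).le_of_angle_eq hσ
        have h2 := (hρ j (Finset.mem_Icc.2 hj)).lt (hρ n hn) (by omega) (by omega)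
        rw [abs_of_nonneg (div_nonneg (by linarith) hpos.le), div_lt_one hpos]
        linarith) hangle
    refine hl (((hasZeroCount_liouville_pow hV hW hW0 h l).const_mul
      (contDiffOn_comb hV _) ((ρ n - σ) ^ l)⁻¹).congr fun x _ => ?_)
    simp only [Finset.mul_sum]
    refine Finset.sum_congr rfl fun j _ => ?_
    rw [div_pow]
    ring

/-- The iteration is run backwards, with coefficients `A j / (ρ j - σ)^l` rescaled so as to tend to
`A m V m`; once such a combination has `m - 1` zeros, `l` forward steps transfer them. For `m = 1`
nothing is claimed, and for `m ≥ 2` all the divisors are positive. -/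
theorem hasZeroCount_comb (hm : 1 ≤ m) (hmn : m ≤ n)
    (hρ : ∀ j ∈ Finset.Icc m n, P.IsNthEigenvalue j (ρ j))
    (hV : ∀ j ∈ Finset.Icc m n, P.IsEigenfunction (ρ j) (V j)) (hA : A m ≠ 0) :
    HasZeroCount (fun x => ∑ j ∈ Finset.Icc m n, A j * V j x) P.α P.β (m - 1) := by
  have hmm : m ∈ Finset.Icc m n := Finset.left_mem_Icc.2 hmn
  have hangle := (hρ m hmm).angle_right
  rcases Nat.lt_or_ge m 2 with h1 | h2
  · exact ⟨∅, fun _ => 0, by simp, by simp, by simp; omega⟩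
  · obtain ⟨σ, W, hW, hW0, hσ⟩ := exists_ground_state hangle (by omega)
    have hpos : ∀ j ∈ Finset.Icc m n, 0 < ρ j - σ := fun j hj =>
      sub_pos.2 ((hρ j hj).lt_of_angle_eq (h2.trans (Finset.mem_Icc.1 hj).1) hσ)
    obtain ⟨l, hl⟩ := exists_hasZeroCount_of_tendsto
      (B := fun l j => ((ρ m - σ) / (ρ j - σ)) ^ l * A j) hV hmm hA (fun j hj => by
        refine tendsto_pow_mul_ite (q := fun j => (ρ m - σ) / (ρ j - σ)) (div_self (hpos m hmm).ne')
          (fun hne => ?_) A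
        have hmj := (Finset.mem_Icc.1 hj).1
        have h2 := (hρ m hmm).lt (hρ j hj) hm (by omega)
        rw [abs_of_nonneg (div_nonneg (hpos m hmm).le (hpos j hj).le), div_lt_one (hpos j hj)]
        linarith) hangle
    refine ((hasZeroCount_liouville_pow hV hW hW0 hl l).const_mul
      (contDiffOn_comb hV _) ((ρ m - σ) ^ l)⁻¹).congr fun x _ => ?_
    simp only [Finset.mul_sum]
    refine Finset.sum_congr rfl fun j hj => ?_
    have h1 := (hpos m hmm).ne'
    have h2 := (hpos j hj).ne'
    rw [div_pow]
    field_simp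

end SturmLiouvilleProblem

end

theorem theorem3p1 (P : SturmLiouvilleProblem) (m n : ℕ) (hm : 1 ≤ m) (hmn : m ≤ n)
    (ρ : ℕ → ℝ) (V : ℕ → ℝ → ℝ)
    (hρ : ∀ j ∈ Finset.Icc m n, P.IsNthEigenvalue j (ρ j))
    (hV : ∀ j ∈ Finset.Icc m n, P.IsEigenfunction (ρ j) (V j))
    (A : ℕ → ℝ) (hA : A m * A n ≠ 0) :
    numZeros (fun x => ∑ j ∈ Finset.Icc m n, A j * V j x) P.α P.β ≤ ((n - 1 : ℕ) : ℕ∞) ∧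
    ((m - 1 : ℕ) : ℕ∞) ≤ numZeros (fun x => ∑ j ∈ Finset.Icc m n, A j * V j x) P.α P.β :=
  ⟨numZeros_le_of_not_hasZeroCount
      (SturmLiouvilleProblem.not_hasZeroCount_comb hm hmn hρ hV (right_ne_zero_of_mul hA)),
    (SturmLiouvilleProblem.hasZeroCount_comb hm hmn hρ hV (left_ne_zero_of_mul hA)).le_numZeros⟩
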